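/- Let $s\in\{1,-1\}$ and let $A(\varepsilon)$ be holomorphic near $\varepsilon=0$. Consider the family of vector fields on $\mathbb C^2$ (with $u=xy$) $$\dot x=x\bigl(i+(\varepsilon+su)(1-A(\varepsilon)u)\bigr),\qquad \dot y=y\bigl(-i+(\varepsilon+su)(1-A(\varepsilon)u)\bigr),$$ and let $Q_{0,\varepsilon}=L_{-1}\circ\tau^{\pi}_\varepsilon$ be its formal semi-monodromy, where $\tau^\pi_\varepsilon$ is the time $\pi$ map of $\dot w=w(\varepsilon+sw^2)(1-A(\varepsilon)w^2)$ and $L_{-1}(w)=-w$. Let $Q_\varepsilon$ be an admissible family: $(\varepsilon,x)\mapsto Q_\varepsilon(x)$ is holomorphic near $(0,0)$, $Q_\varepsilon(0)=0$, $Q_0'(0)=-1$ and $Q_\varepsilon^{\circ2}(x)=x+x(\varepsilon+sx^2)(2\pi+O(\varepsilon)+O(x))$ with a holomorphic last factor. Write $Q_\varepsilon=(\mathrm{id}+g_\varepsilon)\circ Q_{0,\varepsilon}$. *Construction.* Blow up the origin, $(x,y)=(Xy,y)$, so that $\dot X=2iX$, and let $\zeta=\log|X|+i\arg X$ be the coordinate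 on the universal covering of $\mathbb C^*=\{X\neq0\}$. For $r>0$ put $$\widetilde{\mathcal M}=\{(\zeta,y):\ -\tfrac{\pi}{4}<\operatorname{Im}\zeta<2\pi+\tfrac{\pi}{4},\ |y|<r,\ |e^\zeta y|<r\},$$ the covering of the blown-up bidisk $|x|,|y|<r$, with the pulled back field $\widetilde v_\varepsilon$ and its foliation (which is defined for all $y\in\mathbb C$). Let $S'=\{|\operatorname{Im}\zeta|<\pi/4\}$ and $S=\{|\operatorname{Im}\zeta-2\pi|<\pi/4\}$. For $\zeta\in S$ and $\zeta'=\zeta-2\pi i\in S'$ let $h_{\varepsilon,\zeta}$ and $h_{\varepsilon,\zeta'}$ be the holonomies along the leaves, over line segments in the coordinate $\zeta$, from the fibre over $\zeta$ to the fibre over $2\pi i$, and from the fibre over $\zeta'$ to the fibre over $0$, respectively. The sealing map is $$\Gamma_\varepsilon(\zeta,y)=\bigl(\zeta',\,h_{\varepsilon,\zeta'}^{-1}\circ(\mathrm{id}+g_\varepsilon)\circ h_{\varepsilon,\zeta}(y)\bigr),\qquad \zeta\in S .$$ Let $\mathcal M_\varepsilon$ be the topological quotient of $\widetilde{\mathcal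 M}$ obtained by identifying $p$ with $\Gamma_\varepsilon(p)$ whenever $p$ lies over $S$ and $p,\Gamma_\varepsilon(p)\in\widetilde{\mathcal M}$. The function $X=e^\zeta$ descends to $\mathcal M_\varepsilon$; the cross section $\Sigma=\{x=y\}$ is parametrized by $x\mapsto\sigma(x)=[(\zeta,y)=(0,x)]$, $|x|<r$. *Statement.* There are $\delta>0$ and $r_0>0$ such that for every $0<r\le r_0$ there is $0<\rho\le r$ such that for all $|\varepsilon|<\delta$: 1. $\Gamma_\varepsilon$ is a well-defined map, with values in $S'\times\mathbb C$, on the whole part of $\widetilde{\mathcal M}$ over $S$. 2. $\mathcal M_\varepsilon$ is a Hausdorff space and carries the structure of a complex manifold of dimension $2$ for which the projection $\widetilde{\mathcal M}\to\mathcal M_\varepsilon$ is a local biholomorphism, and $\widetilde v_\varepsilon$ induces a vector field $v_\varepsilon$ on $\mathcal M_\varepsilon$ (related to $\widetilde v_\varepsilon$ by the projection). 3. The monodromy $\Sigma\to\Sigma$ of $v_\varepsilon$ along the leaves of its foliation coincides with $Q_\varepsilon$: for all $|x|<\rho$ one has $|Q_\varepsilon(x)|<r$, and for $|x'|<r$ the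 loop $X=e^{i\theta}$, $0\le\theta\le2\pi$, has a lift to a leaf of $v_\varepsilon$ from $\sigma(x)$ to $\sigma(x')$ if and only if $x'=Q_\varepsilon(x)$. -/

import Mathlib

open Set Filter Topology Metric
open scoped Manifold ContDiff

noncomputable section

namespace WeakFocus

/-! ### The normal form and its blow-up -/

/-- The radial factor `(ε + s u) (1 - a u)` of the normal form, `s = ±1`, `a = A(ε)`. -/
def radial (s a ε u : ℂ) : ℂ := (ε + s * u) * (1 - a * u)

/-- The normal form vector field on `ℂ²`, with `u = x y`:
`x' = x (i + (ε + s u)(1 - a u))`, `y' = y (-i + (ε + s u)(1 - a u))`. -/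
def normalForm (s a ε : ℂ) (p : ℂ × ℂ) : ℂ × ℂ :=
  (p.1 * (Complex.I + radial s a ε (p.1 * p.2)), p.2 * (-Complex.I + radial s a ε (p.1 * p.2)))

/-- The blow-down map `(X, y) ↦ (X y, y)` composed with the universal covering
`ζ ↦ X = exp ζ` of `ℂ*`, where `ζ = log |X| + i arg X`. -/
def blowDown (p : ℂ × ℂ) : ℂ × ℂ := (Complex.exp p.1 * p.2, p.2)

/-- The pullback of the normal form to the covering of the blow-up, in the coordinates `(ζ, y)`:
`ζ' = 2 i` (that is, `X' = 2 i X`) and `y' = y (-i + (ε + s u)(1 - a u))` with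
`u = x y = exp ζ * y²`. -/
def liftedField (s a ε : ℂ) (p : ℂ × ℂ) : ℂ × ℂ :=
  (2 * Complex.I, p.2 * (-Complex.I + radial s a ε (Complex.exp p.1 * p.2 ^ 2)))

/-- The derivative of the blow-down map. -/
theorem hasFDerivAt_blowDown (p : ℂ × ℂ) :
    HasFDerivAt blowDown
      ((Complex.exp p.1 • ContinuousLinearMap.snd ℂ ℂ ℂ +
        p.2 • Complex.exp p.1 • ContinuousLinearMap.fst ℂ ℂ ℂ).prod
          (ContinuousLinearMap.snd ℂ ℂ ℂ)) p := by
  have h1 : HasFDerivAt (fun q : ℂ × ℂ => Complex.exp q.1)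
      (Complex.exp p.1 • ContinuousLinearMap.fst ℂ ℂ ℂ) p := hasFDerivAt_fst.cexp
  have h2 : HasFDerivAt (fun q : ℂ × ℂ => q.2) (ContinuousLinearMap.snd ℂ ℂ ℂ) p := hasFDerivAt_snd
  exact (h1.mul h2).prodMk h2

/-- `liftedField` is indeed the pullback of `normalForm`: the two are related by `blowDown`. -/
theorem fderiv_blowDown_liftedField (s a ε : ℂ) (p : ℂ × ℂ) :
    fderiv ℂ blowDown p (liftedField s a ε p) = normalForm s a ε (blowDown p) := by
  rw [(hasFDerivAt_blowDown p).fderiv]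
  have hu : Complex.exp p.1 * p.2 * p.2 = Complex.exp p.1 * p.2 ^ 2 := by ring
  ext
  · simp [liftedField, normalForm, blowDown, hu]
    ring
  · simp [liftedField, normalForm, blowDown, hu]

/-! ### The formal semi-monodromy and admissible families -/

/-- Graph of the semi-monodromy `Q₀ = L₋₁ ∘ τ^π` of the normal form: `τ^π` is the time `π` map of
`w' = w (ε + s w²)(1 - a w²)`, and `L₋₁ w = -w`. -/
def IsSemiMonodromy (s a ε x z : ℂ) : Prop :=
  ∃ w : ℝ → ℂ, w 0 = x ∧ z = -w Real.pi ∧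
    ∀ t ∈ Icc (0 : ℝ) Real.pi,
      HasDerivWithinAt w (w t * radial s a ε (w t ^ 2)) (Icc 0 Real.pi) t

/-- An admissible family: a germ at `(ε, x) = (0, 0)` of a holomorphic family of maps `Q ε` fixing
the origin, unfolding a germ `Q 0` of multiplier `-1` and codimension one, and prepared:
`Q ε (Q ε x) = x + x (ε + s x²)(2π + O(ε) + O(x))`. -/
structure IsAdmissible (s : ℂ) (Q : ℂ → ℂ → ℂ) : Prop where
  holomorphic : AnalyticAt ℂ (fun p : ℂ × ℂ => Q p.1 p.2) (0, 0)
  fixes_zero : ∀ᶠ ε in 𝓝 (0 : ℂ), Q ε 0 = 0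
  multiplier : deriv (Q 0) 0 = -1
  prepared : ∃ k : ℂ × ℂ → ℂ, AnalyticAt ℂ k (0, 0) ∧ k (0, 0) = 2 * Real.pi ∧
    ∀ᶠ p : ℂ × ℂ in 𝓝 (0, 0),
      Q p.1 (Q p.1 p.2) = p.2 + p.2 * (p.1 + s * p.2 ^ 2) * k p

/-- Graph of the germ `id + g` of the decomposition `Q = (id + g) ∘ Q₀`, i.e. of `Q ∘ Q₀⁻¹`. -/
def IsIdAddG (s a ε : ℂ) (f : ℂ → ℂ) (z z' : ℂ) : Prop :=
  ∃ x : ℂ, IsSemiMonodromy s a ε x z ∧ z' = f x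

/-! ### The covering, the flaps and the sealing -/

/-- The part of the covering of the blow-up lying over the bidisk `|x| < r`, `|y| < r` and over
`-π/4 < arg X < 2π + π/4`. It contains the covering `y = 0` of the divisor. In the other chart of
the blow-up the coordinates of `(ζ, y)` are `x = exp ζ * y` and `Y = exp (-ζ)`. -/
def coverDomain (r : ℝ) : TopologicalSpace.Opens (ℂ × ℂ) where
  carrier := {p | -(Real.pi / 4) < p.1.im ∧ p.1.im < 2 * Real.pi + Real.pi / 4 ∧
    ‖p.2‖ < r ∧ ‖Complex.exp p.1 * p.2‖ < r}
  is_open' := by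
    refine IsOpen.and ?_ (IsOpen.and ?_ (IsOpen.and ?_ ?_))
    · exact isOpen_lt (by fun_prop) (by fun_prop)
    · exact isOpen_lt (by fun_prop) (by fun_prop)
    · exact isOpen_lt (by fun_prop) (by fun_prop)
    · exact isOpen_lt (by fun_prop) (by fun_prop)

/-- The base of the flap `S'`: `-π/4 < arg X < π/4`. -/
def flapStart : Set ℂ := {ζ | -(Real.pi / 4) < ζ.im ∧ ζ.im < Real.pi / 4}

/-- The base of the flap `S`: `2π - π/4 < arg X < 2π + π/4`. -/
def flapEnd : Set ℂ :=
  {ζ | 2 * Real.pi - Real.pi / 4 < ζ.im ∧ ζ.im < 2 * Real.pi + Real.pi / 4}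

/-- Graph of the holonomy `{ζ₀} × ℂ → {ζ₁} × ℂ` along the leaves of the foliation of
`liftedField`, over the segment from `ζ₀` to `ζ₁`: the function `η` lifts the segment
`ζ(t) = ζ₀ + t (ζ₁ - ζ₀)` to the leaf, that is, it solves `dy/dζ = (liftedField).2/(liftedField).1`
along it. -/
def IsHolonomy (s a ε ζ₀ ζ₁ y₀ y₁ : ℂ) : Prop :=
  ∃ η : ℝ → ℂ, η 0 = y₀ ∧ η 1 = y₁ ∧
    ∀ t ∈ Icc (0 : ℝ) 1,
      HasDerivWithinAt η
        ((ζ₁ - ζ₀) * ((liftedField s a ε (ζ₀ + t * (ζ₁ - ζ₀), η t)).2 /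
          (liftedField s a ε (ζ₀ + t * (ζ₁ - ζ₀), η t)).1)) (Icc 0 1) t

/-- Graph of the sealing map. A point `p = (ζ, y)` over the flap `S` is sent to the point
`q = (ζ - 2πi, Δ y)` over the flap `S'` with the same projection to `ℂ*`, where
`Δ = (h')⁻¹ ∘ (id + g) ∘ h`, `h` is the holonomy from the fibre over `ζ` to the fibre over
`2πi` (i.e. over `X = 1` in `S`) and `h'` is the holonomy from the fibre over `ζ - 2πi` to the
fibre over `0` (i.e. over `X = 1` in `S'`). -/
def IsSealed (s a ε : ℂ) (f : ℂ → ℂ) (p q : ℂ × ℂ) : Prop :=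
  p.1 ∈ flapEnd ∧ q.1 ∈ flapStart ∧ q.1 = p.1 - 2 * Real.pi * Complex.I ∧
    ∃ z z' : ℂ, IsHolonomy s a ε p.1 (2 * Real.pi * Complex.I) p.2 z ∧
      IsIdAddG s a ε f z z' ∧ IsHolonomy s a ε q.1 0 q.2 z'

/-! ### The sealed space -/

/-- The space `M`: the quotient of the covering by the sealing map. -/
def SealedSpace (s a ε : ℂ) (f : ℂ → ℂ) (r : ℝ) : Type :=
  Quot fun p q : coverDomain r => IsSealed s a ε f p.1 q.1

/-- The quotient topology. -/
instance (s a ε : ℂ) (f : ℂ → ℂ) (r : ℝ) : TopologicalSpace (SealedSpace s a ε f r) :=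
  inferInstanceAs (TopologicalSpace (Quot _))

variable {s a ε : ℂ} {f : ℂ → ℂ} {r : ℝ}

/-- The projection from the covering to the quotient. -/
def SealedSpace.proj (p : coverDomain r) : SealedSpace s a ε f r := Quot.mk _ p

/-- The coordinate `X` on the quotient, i.e. the projection to the base `ℂ*`. -/
def SealedSpace.base : SealedSpace s a ε f r → ℂ :=
  Quot.lift (fun p => Complex.exp p.1.1) (by
    rintro p q ⟨-, -, h, -⟩
    rw [h, Complex.exp_sub, Complex.exp_two_pi_mul_I, div_one])

/-- The cross section `Σ = {x = y} = {X = 1}`, parametrized by the coordinate `x = y`. -/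
def SealedSpace.sectionPt (x : ball (0 : ℂ) r) : SealedSpace s a ε f r :=
  SealedSpace.proj ⟨(0, x), by
    have hx : ‖(x : ℂ)‖ < r := mem_ball_zero_iff.mp x.2
    have hpi := Real.pi_pos
    refine ⟨?_, ?_, hx, ?_⟩
    · simpa using by positivity
    · simpa using by positivity
    · simpa using hx⟩

/-- The chart structure makes the quotient a Hausdorff complex manifold of dimension 2 such that
the projection is a local biholomorphism. -/
structure SealedSpace.IsComplexManifold (cs : ChartedSpace (ℂ × ℂ) (SealedSpace s a ε f r)) :
    Prop where
  hausdorff : T2Space (SealedSpace s a ε f r)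
  isManifold : IsManifold 𝓘(ℂ, ℂ × ℂ) ω (SealedSpace s a ε f r)
  proj_local_biholomorphism : IsLocalDiffeomorph 𝓘(ℂ, ℂ × ℂ) 𝓘(ℂ, ℂ × ℂ) ω
    (SealedSpace.proj : coverDomain r → SealedSpace s a ε f r)

/-- `v` is the vector field induced on the quotient by the lifted field: the two are related by
the projection. -/
def SealedSpace.IsInducedField [ChartedSpace (ℂ × ℂ) (SealedSpace s a ε f r)]
    (v : ∀ m : SealedSpace s a ε f r, TangentSpace 𝓘(ℂ, ℂ × ℂ) m) : Prop :=
  ∀ p : coverDomain r,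
    mfderiv 𝓘(ℂ, ℂ × ℂ) 𝓘(ℂ, ℂ × ℂ)
      (SealedSpace.proj : coverDomain r → SealedSpace s a ε f r) p
      (liftedField s a ε p.1 : ℂ × ℂ) = v (SealedSpace.proj p)

/-- `γ` is the lift to a leaf of the foliation of `v` of the loop `X = exp (iθ)`, `0 ≤ θ ≤ 2π`,
which generates the fundamental group of the base `ℂ*`: its velocity is everywhere in the complex
line spanned by `v`, and it projects to the loop. -/
def SealedSpace.IsLeafLiftOfLoop [ChartedSpace (ℂ × ℂ) (SealedSpace s a ε f r)]
    (v : ∀ m : SealedSpace s a ε f r, TangentSpace 𝓘(ℂ, ℂ × ℂ) m)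
    (γ : ℝ → SealedSpace s a ε f r) : Prop :=
  ∀ θ ∈ Icc (0 : ℝ) (2 * Real.pi),
    (γ θ).base = Complex.exp (θ * Complex.I) ∧
    ∃ c : ℂ, HasMFDerivWithinAt 𝓘(ℝ, ℝ) 𝓘(ℝ, ℂ × ℂ) γ (Icc 0 (2 * Real.pi)) θ
      (ContinuousLinearMap.smulRight (1 : ℝ →L[ℝ] ℝ) (c • v (γ θ) : ℂ × ℂ))

/-- Graph of the monodromy `Σ → Σ` of `v`: the leaf lift of the loop that starts at the point `x`
of `Σ` ends at the point `x'` of `Σ`. -/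
def SealedSpace.IsMonodromy [ChartedSpace (ℂ × ℂ) (SealedSpace s a ε f r)]
    (v : ∀ m : SealedSpace s a ε f r, TangentSpace 𝓘(ℂ, ℂ × ℂ) m)
    (x x' : ball (0 : ℂ) r) : Prop :=
  ∃ γ : ℝ → SealedSpace s a ε f r, SealedSpace.IsLeafLiftOfLoop v γ ∧
    γ 0 = SealedSpace.sectionPt x ∧ γ (2 * Real.pi) = SealedSpace.sectionPt x'

end WeakFocus

end

/-! In the coordinate w = e^{ζ/2} y one has w² = e^ζ y² = u, and the rotation terms cancel: along
the leaves dw/dζ = w · radial(w²) / (2i). So the holonomy from ζ₀ to ζ₁ is the time (ζ₁ - ζ₀)/(2i)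
map of an autonomous polynomial field (`isHolonomy_iff`). One full turn takes time π, and e^{πi} =
-1 supplies L₋₁, so the holonomy from the fibre over 0 to the fibre over 2πi is Q₀.

Label each leaf by the point where it meets the fibre over 0. By the group law, (id + g) ∘ h = Q ∘
Q₀⁻¹ ∘ h sends a point to Q(label). Hence in the coordinates (ζ, label) the field is the constant
(2i, 0) and the sealing is (ζ, x) ↦ (ζ - 2πi, Q x) (`fderiv_rectify_liftedField`,
`IsSealable.isSealed_iff_label`): the sealed space is a suspension of Q. In every chart a leaf lift
of the loop has velocity (i, 0), so it is determined by its starting point. The lift from x is θ ↦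
(iθ, x), and its end (2πi, x) is glued to (0, Q x).

The analytic difficulty is that |Re ζ| is unbounded on the covering, hence so are the holonomy
times. The bidisk however gives |w| < r e^{-|Re ζ|/2}, whereas with |radial| ≤ 1/8 a passage of
modulus at most |Re ζ|/2 + 4 expands by at most e^{|Re ζ|/16 + 1/2}. All labels therefore stay in a
disk on which Q is injective with nonzero derivative. So the gluing is defined and continuous on the
whole covering, even where its image leaves it; this makes the identification relation closed and
the quotient Hausdorff. Analyticity of the flow in time and initial value comes from the inverse
function theorem applied to the Picard operator on C([0, 1], ℂ). -/

noncomputable section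

namespace WeakFocus

/-! ### Flows of entire vector fields on the line in complex time -/

/-- Graph of the time `c` map of `w' = F w`, the time running over the segment from `0` to `c`. -/
def IsFlow (F : ℂ → ℂ) (c w₀ w₁ : ℂ) : Prop :=
  ∃ η : ℝ → ℂ, η 0 = w₀ ∧ η 1 = w₁ ∧
    ∀ t ∈ Icc (0 : ℝ) 1, HasDerivWithinAt η (c * F (η t)) (Icc 0 1) t

theorem hasDerivWithinAt_Ici_of_Icc {E : Type*} [NormedAddCommGroup E] [NormedSpace ℝ E]
    {f : ℝ → E} {f' : E} {a b t : ℝ} (ht : t ∈ Ico a b)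
    (h : HasDerivWithinAt f f' (Icc a b) t) : HasDerivWithinAt f f' (Ici t) t :=
  h.mono_of_mem_nhdsWithin (mem_of_superset (Icc_mem_nhdsGE ht.2) (Icc_subset_Icc_left ht.1))

/-- The two curves sweep out a compact set, on which a C¹ field is Lipschitz, although a polynomial
field is not Lipschitz on the whole plane. -/
theorem eqOn_of_flow {F : ℂ → ℂ} (hF : ContDiff ℂ 1 F) {c : ℂ} {η₁ η₂ : ℝ → ℂ}
    (h₁ : ∀ t ∈ Icc (0 : ℝ) 1, HasDerivWithinAt η₁ (c * F (η₁ t)) (Icc 0 1) t)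
    (h₂ : ∀ t ∈ Icc (0 : ℝ) 1, HasDerivWithinAt η₂ (c * F (η₂ t)) (Icc 0 1) t)
    (h0 : η₁ 0 = η₂ 0) : EqOn η₁ η₂ (Icc 0 1) := by
  have c₁ : ContinuousOn η₁ (Icc 0 1) := fun t ht => (h₁ t ht).continuousWithinAt
  have c₂ : ContinuousOn η₂ (Icc 0 1) := fun t ht => (h₂ t ht).continuousWithinAt
  have hK : IsCompact (η₁ '' Icc 0 1 ∪ η₂ '' Icc 0 1) :=
    (isCompact_Icc.image_of_continuousOn c₁).union (isCompact_Icc.image_of_continuousOn c₂)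
  have hL : ContDiff ℂ 1 fun w => c * F w := contDiff_const.mul hF
  obtain ⟨K, hK⟩ := LocallyLipschitzOn.exists_lipschitzOnWith_of_compact hK
    hL.locallyLipschitz.locallyLipschitzOn
  exact ODE_solution_unique_of_mem_Icc_right (v := fun _ w => c * F w) (fun _ _ => hK) c₁
    (fun t ht => hasDerivWithinAt_Ici_of_Icc ht (h₁ t (Ico_subset_Icc_self ht)))
    (fun t ht => Or.inl (mem_image_of_mem _ (Ico_subset_Icc_self ht))) c₂
    (fun t ht => hasDerivWithinAt_Ici_of_Icc ht (h₂ t (Ico_subset_Icc_self ht)))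
    (fun t ht => Or.inr (mem_image_of_mem _ (Ico_subset_Icc_self ht))) h0

theorem IsFlow.unique {F : ℂ → ℂ} (hF : ContDiff ℂ 1 F) {c w₀ w₁ w₁' : ℂ}
    (h : IsFlow F c w₀ w₁) (h' : IsFlow F c w₀ w₁') : w₁ = w₁' := by
  obtain ⟨η, h0, h1, h⟩ := h
  obtain ⟨η', h0', h1', h'⟩ := h'
  rw [← h1, ← h1']
  exact eqOn_of_flow hF h h' (h0.trans h0'.symm) (right_mem_Icc.2 zero_le_one)

theorem IsFlow.symm {F : ℂ → ℂ} {c w₀ w₁ : ℂ} (h : IsFlow F c w₀ w₁) : IsFlow F (-c) w₁ w₀ := by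
  obtain ⟨η, h0, h1, h⟩ := h
  refine ⟨fun t => η (1 - t), by simpa using h1, by simpa using h0, fun t ht => ?_⟩
  have ht' : 1 - t ∈ Icc (0 : ℝ) 1 := ⟨by linarith [ht.2], by linarith [ht.1]⟩
  have hd : HasDerivWithinAt (fun t : ℝ => 1 - t) (-1) (Icc 0 1) t :=
    ((hasDerivAt_id t).const_sub 1).hasDerivWithinAt
  have := (h _ ht').scomp t hd fun u hu => ⟨by linarith [hu.2], by linarith [hu.1]⟩
  convert! this using 1
  simp

theorem isFlow_neg_iff {F : ℂ → ℂ} {c w₀ w₁ : ℂ} : IsFlow F (-c) w₁ w₀ ↔ IsFlow F c w₀ w₁ :=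
  ⟨fun h => by simpa using h.symm, IsFlow.symm⟩

/-- Restricting a flow line to an initial segment. -/
theorem isFlow_of_mem_Icc {F : ℂ → ℂ} {c : ℂ} {η : ℝ → ℂ}
    (h : ∀ t ∈ Icc (0 : ℝ) 1, HasDerivWithinAt η (c * F (η t)) (Icc 0 1) t) {t : ℝ}
    (ht : t ∈ Icc (0 : ℝ) 1) : IsFlow F (t * c) (η 0) (η t) := by
  refine ⟨fun u => η (t * u), by simp, by simp, fun u hu => ?_⟩
  have hm : ∀ u ∈ Icc (0 : ℝ) 1, t * u ∈ Icc (0 : ℝ) 1 := fun u hu =>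
    ⟨mul_nonneg ht.1 hu.1, mul_le_one₀ ht.2 hu.1 hu.2⟩
  have hd : HasDerivWithinAt (fun u : ℝ => t * u) t (Icc 0 1) u := by
    simpa using ((hasDerivAt_id u).const_mul t).hasDerivWithinAt
  have := (h _ (hm u hu)).scomp u hd hm
  convert! this using 1
  simp [mul_assoc]

/-! ### Existence -/

/-- Projection of the plane to the square `|Re|, |Im| ≤ R`. -/
def clampSquare (R : ℝ) (w : ℂ) : ℂ := ⟨max (-R) (min R w.re), max (-R) (min R w.im)⟩

theorem abs_max_neg_min_le {R : ℝ} (hR : 0 ≤ R) (x : ℝ) : |max (-R) (min R x)| ≤ |x| := by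
  rcases abs_cases x with h | h <;> rw [h.1] <;> apply abs_le.2 <;> constructor <;>
    grind

theorem abs_max_neg_min_sub_le (R x y : ℝ) :
    |max (-R) (min R x) - max (-R) (min R y)| ≤ |x - y| := by
  rw [max_comm, max_comm (-R)]
  refine (abs_max_sub_max_le_abs _ _ _).trans ?_
  simpa using abs_min_sub_min_le_max R x R y

theorem norm_clampSquare_le {R : ℝ} (hR : 0 ≤ R) (w : ℂ) : ‖clampSquare R w‖ ≤ ‖w‖ := by
  rw [Complex.norm_def, Complex.norm_def]
  apply Real.sqrt_le_sqrt
  simp only [Complex.normSq_apply, clampSquare]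
  have h1 := abs_mul_abs_self w.re ▸ abs_mul_abs_self (max (-R) (min R w.re)) ▸
    mul_self_le_mul_self (abs_nonneg _) (abs_max_neg_min_le hR w.re)
  have h2 := abs_mul_abs_self w.im ▸ abs_mul_abs_self (max (-R) (min R w.im)) ▸
    mul_self_le_mul_self (abs_nonneg _) (abs_max_neg_min_le hR w.im)
  linarith

/-- Clamping each coordinate is plainly 1-Lipschitz, but the square sticks out of the disk of radius
R; this is why bounds on the field are later required on the disk of radius 2R. -/
theorem norm_clampSquare_le_two_mul {R : ℝ} (hR : 0 ≤ R) (w : ℂ) : ‖clampSquare R w‖ ≤ 2 * R := by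
  refine (Complex.norm_le_abs_re_add_abs_im _).trans ?_
  have h : ∀ x : ℝ, |max (-R) (min R x)| ≤ R := fun x => abs_le.2 ⟨le_max_left _ _, by grind⟩
  have := add_le_add (h w.re) (h w.im)
  simpa [clampSquare, two_mul] using this

theorem clampSquare_eq_self {R : ℝ} {w : ℂ} (hw : ‖w‖ ≤ R) : clampSquare R w = w := by
  have h1 := abs_le.1 ((Complex.abs_re_le_norm w).trans hw)
  have h2 := abs_le.1 ((Complex.abs_im_le_norm w).trans hw)
  apply Complex.ext <;> simp only [clampSquare] <;> grind

theorem lipschitzWith_clampSquare (R : ℝ) : LipschitzWith 1 (clampSquare R) := by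
  refine LipschitzWith.of_dist_le_mul fun z w => ?_
  rw [NNReal.coe_one, one_mul, dist_eq_norm, dist_eq_norm, Complex.norm_def, Complex.norm_def]
  apply Real.sqrt_le_sqrt
  simp only [Complex.normSq_apply, clampSquare, Complex.sub_re, Complex.sub_im]
  have h1 := mul_self_le_mul_self (abs_nonneg _) (abs_max_neg_min_sub_le R z.re w.re)
  have h2 := mul_self_le_mul_self (abs_nonneg _) (abs_max_neg_min_sub_le R z.im w.im)
  rw [abs_mul_abs_self, abs_mul_abs_self] at h1 h2
  linarith

/-- A flow line of a field with `|F w| ≤ κ |w|` grows at most exponentially. -/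
theorem norm_le_of_flow {F : ℂ → ℂ} {κ : ℝ} {c : ℂ} {η : ℝ → ℂ}
    (hb : ∀ t ∈ Icc (0 : ℝ) 1, ‖F (η t)‖ ≤ κ * ‖η t‖)
    (h : ∀ t ∈ Icc (0 : ℝ) 1, HasDerivWithinAt η (c * F (η t)) (Icc 0 1) t)
    {t : ℝ} (ht : t ∈ Icc (0 : ℝ) 1) : ‖η t‖ ≤ ‖η 0‖ * Real.exp (κ * ‖c‖ * t) := by
  have := norm_le_gronwallBound_of_norm_deriv_right_le (δ := ‖η 0‖) (K := κ * ‖c‖) (ε := 0)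
    (fun t ht => (h t ht).continuousWithinAt)
    (fun t ht => hasDerivWithinAt_Ici_of_Icc ht (h t (Ico_subset_Icc_self ht))) le_rfl
    (fun t ht => by
      rw [norm_mul]
      have := mul_le_mul_of_nonneg_left (hb t (Ico_subset_Icc_self ht)) (norm_nonneg c)
      linarith) t ht
  rwa [gronwallBound_ε0, sub_zero] at this

/-- The clamped field is bounded and globally Lipschitz, so Picard–Lindelöf gives a solution on all
of [0, 1]. Grönwall keeps that solution inside the disk of radius R, where clamping does nothing, so
it solves the original equation. -/
theorem exists_isFlow {F : ℂ → ℂ} (hF : ContDiff ℂ 1 F) {κ R : ℝ} (hκ : 0 ≤ κ) (hR : 0 ≤ R)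
    (hb : ∀ w, ‖w‖ ≤ 2 * R → ‖F w‖ ≤ κ * ‖w‖) {c w : ℂ} (hw : ‖w‖ * Real.exp (κ * ‖c‖) ≤ R) :
    ∃ w₁, IsFlow F c w w₁ ∧ ‖w₁‖ ≤ ‖w‖ * Real.exp (κ * ‖c‖) := by
  obtain ⟨K, hK⟩ := LocallyLipschitzOn.exists_lipschitzOnWith_of_compact
    (isCompact_closedBall (0 : ℂ) (2 * R))
    (contDiff_const.mul hF : ContDiff ℂ 1 fun w => c * F w).locallyLipschitz.locallyLipschitzOn
  have hm : ∀ w, clampSquare R w ∈ closedBall (0 : ℂ) (2 * R) := fun w => by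
    simpa using norm_clampSquare_le_two_mul hR w
  have hb' : ∀ w, ‖F (clampSquare R w)‖ ≤ κ * ‖w‖ := fun w =>
    (hb _ (norm_clampSquare_le_two_mul hR w)).trans (by gcongr; exact norm_clampSquare_le hR w)
  have hLip : LipschitzWith K fun w => c * F (clampSquare R w) := by
    have := hK.comp ((lipschitzWith_clampSquare R).lipschitzOnWith (s := univ)) fun w _ => hm w
    rw [mul_one, lipschitzOnWith_univ] at this
    exact this
  obtain ⟨L, hL⟩ : ∃ L : NNReal, ‖c‖ * (κ * (2 * R)) = L := ⟨⟨_, by positivity⟩, rfl⟩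
  have hPL : IsPicardLindelof (fun _ : ℝ => fun w => c * F (clampSquare R w))
      (⟨0, by simp⟩ : Icc (0 : ℝ) 1) w L 0 L K := by
    refine IsPicardLindelof.of_time_independent (fun z _ => ?_) hLip.lipschitzOnWith (by simp)
    rw [← hL, norm_mul]
    have := hb _ (norm_clampSquare_le_two_mul hR z)
    have h2 := norm_clampSquare_le_two_mul hR z
    gcongr
    exact this.trans (by gcongr)
  obtain ⟨η, h0, h⟩ := hPL.exists_eq_forall_mem_Icc_hasDerivWithinAt₀
  have hη : ∀ t ∈ Icc (0 : ℝ) 1, ‖η t‖ ≤ ‖w‖ * Real.exp (κ * ‖c‖) := fun t ht => by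
    have := norm_le_of_flow (F := fun w => F (clampSquare R w)) (κ := κ) (fun t _ => hb' _) h ht
    refine this.trans ?_
    rw [show η 0 = w from h0]
    exact mul_le_mul_of_nonneg_left
      (Real.exp_le_exp.2 (mul_le_of_le_one_right (by positivity) ht.2)) (norm_nonneg _)
  refine ⟨η 1, ⟨η, h0, rfl, fun t ht => ?_⟩, hη 1 (by simp)⟩
  have := h t ht
  rwa [clampSquare_eq_self ((hη t ht).trans hw)] at this

/-! ### Analytic dependence on time and initial value -/

/-- Extension of a continuous function on the unit interval to the line. -/
def extendLine (g : C(unitInterval, ℂ)) : ℝ → ℂ := IccExtend zero_le_one g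

theorem continuous_extendLine (g : C(unitInterval, ℂ)) : Continuous (extendLine g) :=
  g.continuous.Icc_extend'

theorem extendLine_coe (g : C(unitInterval, ℂ)) (t : unitInterval) : extendLine g t = g t :=
  IccExtend_val _ _ _

theorem norm_extendLine_le (g : C(unitInterval, ℂ)) (t : ℝ) : ‖extendLine g t‖ ≤ ‖g‖ :=
  g.norm_coe_le_norm _

theorem hasDerivAt_integral_extendLine (g : C(unitInterval, ℂ)) (t : ℝ) :
    HasDerivAt (fun u => ∫ τ in (0 : ℝ)..u, extendLine g τ) (extendLine g t) t :=
  ((continuous_extendLine g).integral_hasStrictDerivAt 0 t).hasDerivAt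

/-- The primitive vanishing at `0`, as an operator on `C([0, 1], ℂ)`. -/
def primitive : C(unitInterval, ℂ) →L[ℂ] C(unitInterval, ℂ) :=
  LinearMap.mkContinuous
    { toFun := fun g => ⟨fun t => ∫ τ in (0 : ℝ)..t, extendLine g τ,
        (continuous_iff_continuousAt.2 fun t =>
          (hasDerivAt_integral_extendLine g t).continuousAt).comp continuous_subtype_val⟩
      map_add' := fun g h => by
        ext t
        exact intervalIntegral.integral_add ((continuous_extendLine g).intervalIntegrable _ _)
          ((continuous_extendLine h).intervalIntegrable _ _)
      map_smul' := fun c g => by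
        ext t
        exact intervalIntegral.integral_smul c _ } 1 (fun g => by
    refine (ContinuousMap.norm_le _ (by positivity)).2 fun t => ?_
    refine (intervalIntegral.norm_integral_le_of_norm_le_const fun τ _ =>
      norm_extendLine_le g τ).trans ?_
    rw [sub_zero, abs_of_nonneg t.2.1, one_mul]
    exact mul_le_of_le_one_right (norm_nonneg _) t.2.2)

theorem primitive_apply (g : C(unitInterval, ℂ)) (t : unitInterval) :
    primitive g t = ∫ τ in (0 : ℝ)..t, extendLine g τ := rfl

theorem extendLine_mul (g h : C(unitInterval, ℂ)) (t : ℝ) :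
    extendLine (g * h) t = extendLine g t * extendLine h t := rfl

/-- A linear Volterra equation `h = g + ∫ D h` has a unique solution. -/
theorem bijective_id_sub_primitive_mul (D : C(unitInterval, ℂ)) : Function.Bijective
    (ContinuousLinearMap.id ℂ C(unitInterval, ℂ) -
      primitive.comp (ContinuousLinearMap.mul ℂ _ D)) := by
  have hE : ∀ t, HasDerivAt (fun u => Complex.exp (∫ τ in (0 : ℝ)..u, extendLine D τ))
      (Complex.exp (∫ τ in (0 : ℝ)..t, extendLine D τ) * extendLine D t) t := fun t =>
    (hasDerivAt_integral_extendLine D t).cexp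
  have hE' : ∀ t, HasDerivAt (fun u => Complex.exp (-∫ τ in (0 : ℝ)..u, extendLine D τ))
      (Complex.exp (-∫ τ in (0 : ℝ)..t, extendLine D τ) * -extendLine D t) t := fun t =>
    (hasDerivAt_integral_extendLine D t).neg.cexp
  constructor
  · refine (injective_iff_map_eq_zero _).2 fun h hh => ?_
    have hh : h = primitive (D * h) := sub_eq_zero.1 hh
    -- Integrating factor: with E = exp(-∫D), the product E ∫Dh has derivative E D (h - ∫Dh), which
    -- vanishes on [0, 1] because h = ∫Dh there.
    have key : ∀ t, HasDerivAt (fun u => Complex.exp (-∫ τ in (0 : ℝ)..u, extendLine D τ) *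
        ∫ τ in (0 : ℝ)..u, extendLine (D * h) τ)
        (Complex.exp (-∫ τ in (0 : ℝ)..t, extendLine D τ) * extendLine D t *
          (extendLine h t - ∫ τ in (0 : ℝ)..t, extendLine (D * h) τ)) t := fun t => by
      convert! (hE' t).mul (hasDerivAt_integral_extendLine (D * h) t) using 1
      rw [extendLine_mul]; ring
    ext t
    have := constant_of_derivWithin_zero (a := (0 : ℝ)) (b := t)
      (fun x _ => (key x).differentiableAt.differentiableWithinAt)
      (fun x hx => by
        have hx' : x ∈ Icc (0 : ℝ) t := Ico_subset_Icc_self hx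
        rw [(key x).hasDerivWithinAt.derivWithin (uniqueDiffOn_Icc (hx.1.trans_lt hx.2) x hx')]
        have : extendLine h x = ∫ τ in (0 : ℝ)..x, extendLine (D * h) τ := by
          have h1 : x ≤ 1 := hx'.2.trans t.2.2
          conv_lhs => rw [hh]
          exact extendLine_coe _ ⟨x, hx.1, h1⟩
        rw [this, sub_self, mul_zero]) t ⟨t.2.1, le_rfl⟩
    simp only [intervalIntegral.integral_same, mul_zero, mul_eq_zero, Complex.exp_ne_zero,
      false_or] at this
    rw [hh, primitive_apply, this]
    rfl
  · intro g
    have hc : Continuous fun t : unitInterval =>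
        Complex.exp (-∫ τ in (0 : ℝ)..t, extendLine D τ) := by
      have : Continuous fun t : ℝ => Complex.exp (-∫ τ in (0 : ℝ)..t, extendLine D τ) :=
        continuous_iff_continuousAt.2 fun t => (hE' t).continuousAt
      exact this.comp continuous_subtype_val
    have hc' : Continuous fun t : unitInterval =>
        Complex.exp (∫ τ in (0 : ℝ)..t, extendLine D τ) := by
      have : Continuous fun t : ℝ => Complex.exp (∫ τ in (0 : ℝ)..t, extendLine D τ) :=
        continuous_iff_continuousAt.2 fun t => (hE t).continuousAt
      exact this.comp continuous_subtype_val
    let Em : C(unitInterval, ℂ) := ⟨_, hc⟩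
    let Ep : C(unitInterval, ℂ) := ⟨_, hc'⟩
    have hEE : ∀ t, extendLine Ep t * extendLine Em t = 1 := fun t => by
      change Complex.exp _ * Complex.exp _ = 1
      rw [← Complex.exp_add, add_neg_cancel, Complex.exp_zero]
    -- Variation of constants: the unknown H = ∫Dh satisfies H' = D H + D g with H(0) = 0, whence H
    -- = `Ep * k`.
    let k := primitive (Em * D * g)
    refine ⟨g + Ep * k, ?_⟩
    have : primitive (D * (g + Ep * k)) = Ep * k := by
      -- both sides have the derivative `D (g + Ep k)`, but only on the unit interval
      ext t
      have hd : ∀ u ∈ uIcc (0 : ℝ) t, HasDerivAt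
          (fun u => Complex.exp (∫ τ in (0 : ℝ)..u, extendLine D τ) *
            ∫ τ in (0 : ℝ)..u, extendLine (Em * D * g) τ) (extendLine (D * (g + Ep * k)) u) u := by
        intro u hu
        rw [uIcc_of_le t.2.1] at hu
        have hu' : u ∈ unitInterval := ⟨hu.1, hu.2.trans t.2.2⟩
        convert! (hE u).mul (hasDerivAt_integral_extendLine (Em * D * g) u) using 1
        have h1 : extendLine (D * (g + Ep * k)) u =
            extendLine D u * (extendLine g u + extendLine Ep u * extendLine k u) := rfl
        have h2 : extendLine (Em * D * g) u =
            extendLine Em u * extendLine D u * extendLine g u := rfl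
        have h3 : extendLine k u = ∫ τ in (0 : ℝ)..u, extendLine (Em * D * g) τ :=
          extendLine_coe k ⟨u, hu'⟩
        have h4 : extendLine Ep u = Complex.exp (∫ τ in (0 : ℝ)..u, extendLine D τ) :=
          extendLine_coe Ep ⟨u, hu'⟩
        rw [h1, ← h3, h2, ← h4]
        linear_combination (-extendLine D u * extendLine g u) * hEE u
      rw [primitive_apply, intervalIntegral.integral_eq_sub_of_hasDerivAt hd
        ((continuous_extendLine _).intervalIntegrable _ _)]
      simp [Ep, k, primitive_apply]
    change g + Ep * k - primitive (D * (g + Ep * k)) = g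
    rw [this, add_sub_cancel_right]

-- Since C([0, 1], ℂ) is a commutative Banach algebra, composing a curve with P is evaluating P in
-- that algebra. Restricting to polynomial fields thus makes the analyticity of the superposition
-- operator purely algebraic.
open Polynomial in
theorem hasFDerivAt_aeval_continuousMap (P : ℂ[X]) (g : C(unitInterval, ℂ)) :
    HasFDerivAt (fun g : C(unitInterval, ℂ) => aeval g P)
      (ContinuousLinearMap.mul ℂ _ (aeval g P.derivative)) g := by
  induction P using Polynomial.induction_on' with
  | add p q hp hq =>
    simp only [map_add]
    exact hp.add hq
  | monomial n a =>
    simp only [aeval_monomial, derivative_monomial]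
    have := ((hasFDerivAt_id (𝕜 := ℂ) g).pow n).const_mul
      (algebraMap ℂ C(unitInterval, ℂ) a)
    convert! this using 1
    ext h t
    simp
    ring

open Polynomial in
theorem contDiff_aeval_continuousMap (P : ℂ[X]) :
    ContDiff ℂ ω (fun g : C(unitInterval, ℂ) => aeval g P) := by
  induction P using Polynomial.induction_on' with
  | add p q hp hq => simpa using hp.add hq
  | monomial n a =>
    simp only [aeval_monomial]
    fun_prop

open Polynomial in
/-- The flow lines of a polynomial field are the fixed points of the Picard operator. -/
theorem isFlow_of_sub_smul_primitive_eq (P : ℂ[X]) {c w : ℂ} {η : C(unitInterval, ℂ)}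
    (h : η - c • primitive (aeval η P) = ContinuousMap.const _ w) :
    IsFlow (fun w => P.eval w) c w (η 1) := by
  have hη : ∀ t : unitInterval, η t = w + c * ∫ τ in (0 : ℝ)..t, extendLine (aeval η P) τ :=
    fun t => by
      have := congrArg (fun g : C(unitInterval, ℂ) => g t) h
      simp only [ContinuousMap.sub_apply, ContinuousMap.smul_apply, ContinuousMap.const_apply,
        primitive_apply, smul_eq_mul] at this
      linear_combination this
  refine ⟨fun t => w + c * ∫ τ in (0 : ℝ)..t, extendLine (aeval η P) τ, by simp,
    (hη 1).symm, fun t ht => ?_⟩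
  have := ((hasDerivAt_integral_extendLine (aeval η P) t).const_mul c).const_add w
  convert! this.hasDerivWithinAt using 1
  change c * P.eval (w + c * ∫ τ in (0 : ℝ)..(⟨t, ht⟩ : unitInterval), _) = _
  rw [← hη ⟨t, ht⟩, show extendLine (aeval η P) t = aeval η P ⟨t, ht⟩ from
    extendLine_coe _ ⟨t, ht⟩, aeval_continuousMap_apply]

-- The converse of `isFlow_of_sub_smul_primitive_eq`; it supplies the base point at which the
-- inverse function theorem is applied.
open Polynomial in
theorem sub_smul_primitive_eq_of_flow (P : ℂ[X]) {c : ℂ} {η : ℝ → ℂ}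
    (h : ∀ t ∈ Icc (0 : ℝ) 1, HasDerivWithinAt η (c * P.eval (η t)) (Icc 0 1) t)
    {g : C(unitInterval, ℂ)} (hg : ∀ t : unitInterval, g t = η t) :
    g - c • primitive (aeval g P) = ContinuousMap.const _ (η 0) := by
  ext t
  have hg' : ∀ u ∈ Icc (0 : ℝ) 1, extendLine (aeval g P) u = P.eval (η u) := fun u hu => by
    rw [show extendLine (aeval g P) u = aeval g P ⟨u, hu⟩ from extendLine_coe _ ⟨u, hu⟩,
      aeval_continuousMap_apply, hg]
  have ht := t.2
  have := intervalIntegral.integral_eq_sub_of_hasDeriv_right_of_le (f := η)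
    (f' := fun u => c * extendLine (aeval g P) u) t.2.1
    (fun u hu => (h u ⟨hu.1, hu.2.trans ht.2⟩).continuousWithinAt.mono
      (Icc_subset_Icc_right ht.2))
    (fun u hu => by
      have hu' : u ∈ Icc (0 : ℝ) 1 := ⟨hu.1.le, hu.2.le.trans ht.2⟩
      rw [hg' u hu']
      exact (hasDerivWithinAt_Ici_of_Icc ⟨hu.1.le, hu.2.trans_le ht.2⟩ (h u hu')).mono
        Ioi_subset_Ici_self)
    ((continuous_const.mul (continuous_extendLine _)).intervalIntegrable _ _)
  rw [intervalIntegral.integral_const_mul] at this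
  simp only [ContinuousMap.sub_apply, ContinuousMap.smul_apply, ContinuousMap.const_apply,
    primitive_apply, smul_eq_mul, hg]
  linear_combination -this

open Polynomial in
/-- The flow of a polynomial field depends analytically on the time and the initial value. -/
theorem IsFlow.exists_contDiffAt (P : ℂ[X]) {c₀ w₀ w₁ : ℂ}
    (h : IsFlow (fun w => P.eval w) c₀ w₀ w₁) :
    ∃ g : ℂ × ℂ → ℂ, ContDiffAt ℂ ω g (c₀, w₀) ∧
      ∀ᶠ p in 𝓝 (c₀, w₀), IsFlow (fun w => P.eval w) p.1 p.2 (g p) := by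
  obtain ⟨η, h0, h1, h⟩ := h
  have hc : Continuous fun t : unitInterval => η t :=
    continuousOn_iff_continuous_domRestrict.1 fun t ht => (h t ht).continuousWithinAt
  let η₀ : C(unitInterval, ℂ) := ⟨_, hc⟩
  -- Carrying the time along as a second component turns the implicit function problem into an
  -- inverse function problem, with joint dependence on time and initial value.
  let Θ : C(unitInterval, ℂ) × ℂ → C(unitInterval, ℂ) × ℂ := fun p =>
    (p.1 - p.2 • primitive (aeval p.1 P), p.2)
  have hΘ : ContDiff ℂ ω Θ := by
    have : ContDiff ℂ ω fun p : C(unitInterval, ℂ) × ℂ => primitive (aeval p.1 P) :=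
      primitive.contDiff.comp ((contDiff_aeval_continuousMap P).comp contDiff_fst)
    exact (contDiff_fst.sub (contDiff_snd.smul this)).prodMk contDiff_snd
  have hΘ0 : Θ (η₀, c₀) = (ContinuousMap.const _ w₀, c₀) := by
    refine Prod.ext ?_ rfl
    rw [← h0]
    exact sub_smul_primitive_eq_of_flow P h fun t => rfl
  let Θ' : C(unitInterval, ℂ) × ℂ →L[ℂ] C(unitInterval, ℂ) × ℂ :=
    (ContinuousLinearMap.fst ℂ _ _ -
      (c₀ • (primitive.comp ((ContinuousLinearMap.mul ℂ _ (aeval η₀ P.derivative)).comp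
        (ContinuousLinearMap.fst ℂ _ _))) +
        (ContinuousLinearMap.snd ℂ C(unitInterval, ℂ) ℂ).smulRight (primitive (aeval η₀ P)))).prod
      (ContinuousLinearMap.snd ℂ _ _)
  have hd : HasFDerivAt Θ Θ' (η₀, c₀) := by
    have h1 : HasFDerivAt (fun p : C(unitInterval, ℂ) × ℂ => primitive (aeval p.1 P))
        (primitive.comp ((ContinuousLinearMap.mul ℂ _ (aeval η₀ P.derivative)).comp
          (ContinuousLinearMap.fst ℂ _ _))) (η₀, c₀) := by
      have h2 := HasFDerivAt.comp (η₀, c₀) (hasFDerivAt_aeval_continuousMap P η₀)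
        (hasFDerivAt_fst (𝕜 := ℂ) (F := ℂ) (p := (η₀, c₀)))
      exact primitive.hasFDerivAt.comp (η₀, c₀) h2
    exact (hasFDerivAt_fst.sub (hasFDerivAt_snd.smul h1)).prodMk hasFDerivAt_snd
  have hΘ'_apply : ∀ p : C(unitInterval, ℂ) × ℂ, Θ' p =
      ((ContinuousLinearMap.id ℂ C(unitInterval, ℂ) - primitive.comp
        (ContinuousLinearMap.mul ℂ _ (c₀ • aeval η₀ P.derivative))) p.1 -
          p.2 • primitive (aeval η₀ P), p.2) := fun p => by
    refine Prod.ext ?_ rfl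
    change p.1 - (c₀ • primitive (aeval η₀ P.derivative * p.1) + p.2 • primitive (aeval η₀ P)) =
      p.1 - primitive ((c₀ • aeval η₀ P.derivative) * p.1) - p.2 • primitive (aeval η₀ P)
    rw [smul_mul_assoc, map_smul, sub_sub]
  -- The derivative of Θ is triangular, with the identity on times and a Volterra operator on
  -- curves, so it is invertible as soon as the latter is.
  have hb := bijective_id_sub_primitive_mul (c₀ • aeval η₀ P.derivative)
  have hinj : Θ'.toLinearMap.ker = ⊥ := by
    refine LinearMap.ker_eq_bot'.2 fun p hp => ?_
    have hp : Θ' p = 0 := hp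
    rw [hΘ'_apply] at hp
    have h2 : p.2 = 0 := congrArg Prod.snd hp
    have h1 : (ContinuousLinearMap.id ℂ C(unitInterval, ℂ) - primitive.comp
        (ContinuousLinearMap.mul ℂ _ (c₀ • aeval η₀ P.derivative))) p.1 -
          p.2 • primitive (aeval η₀ P) = 0 := congrArg Prod.fst hp
    have h3 : p.2 • primitive (aeval η₀ P) = 0 := by
      rw [h2]; exact zero_smul ℂ (primitive (aeval η₀ P))
    rw [h3] at h1
    exact Prod.ext (hb.1 (((sub_zero _).symm.trans h1).trans (map_zero _).symm)) h2
  have hsurj : Θ'.toLinearMap.range = ⊤ := by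
    refine LinearMap.range_eq_top.2 fun q => ?_
    obtain ⟨h, hh⟩ := hb.2 (q.1 + q.2 • primitive (aeval η₀ P))
    refine ⟨(h, q.2), (hΘ'_apply (h, q.2)).trans (Prod.ext ?_ rfl)⟩
    simp only [hh, add_sub_cancel_right]
  let e := ContinuousLinearEquiv.ofBijective Θ' hinj hsurj
  have hd' : HasFDerivAt Θ (e : _ →L[ℂ] _) (η₀, c₀) := by
    rw [ContinuousLinearEquiv.coe_ofBijective]; exact hd
  have hω : (ω : WithTop ℕ∞) ≠ 0 := by simp
  let θ := hΘ.contDiffAt.localInverse hd' hω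
  have hθ : ContDiffAt ℂ ω θ (ContinuousMap.const _ w₀, c₀) := by
    rw [← hΘ0]; exact hΘ.contDiffAt.to_localInverse hd' hω
  have hθr : ∀ᶠ y in 𝓝 (ContinuousMap.const unitInterval w₀, c₀), Θ (θ y) = y := by
    rw [← hΘ0]
    exact (hΘ.contDiffAt.hasStrictFDerivAt' hd' hω).eventually_right_inverse
  have hι : ContDiff ℂ ω fun p : ℂ × ℂ => (ContinuousMap.const unitInterval p.2, p.1) := by
    refine ContDiff.prodMk ?_ contDiff_fst
    have : (fun p : ℂ × ℂ => ContinuousMap.const unitInterval p.2) =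
        fun p : ℂ × ℂ => p.2 • (1 : C(unitInterval, ℂ)) := by
      ext p t; simp
    rw [this]
    exact contDiff_snd.smul contDiff_const
  refine ⟨fun p => (θ (ContinuousMap.const _ p.2, p.1)).1 1, ?_, ?_⟩
  · have h2 : ContDiffAt ℂ ω (fun p : ℂ × ℂ => (θ (ContinuousMap.const _ p.2, p.1)).1) (c₀, w₀) :=
      contDiff_fst.contDiffAt.comp (c₀, w₀)
        (ContDiffAt.comp (c₀, w₀) (g := θ) hθ hι.contDiffAt)
    exact (ContinuousMap.evalCLM ℂ (1 : unitInterval)).contDiff.contDiffAt.comp (c₀, w₀) h2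
  · have := (hι.continuous.tendsto (c₀, w₀)).eventually hθr
    filter_upwards [this] with p hp
    have h2 := congrArg Prod.snd hp
    have h1 := congrArg Prod.fst hp
    refine isFlow_of_sub_smul_primitive_eq P ?_
    simp only [Θ] at h1 h2
    rwa [h2] at h1

/-! ### The flow map -/

open scoped Classical in
/-- The time `c` map of `w' = F w`, with value `0` where it is not defined. -/
def flowMap (F : ℂ → ℂ) (p : ℂ × ℂ) : ℂ :=
  if h : ∃ w₁, IsFlow F p.1 p.2 w₁ then h.choose else 0

/-- The domain of the flow map. -/
def flowDomain (F : ℂ → ℂ) : Set (ℂ × ℂ) := {p | ∃ w₁, IsFlow F p.1 p.2 w₁}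

theorem isFlow_flowMap {F : ℂ → ℂ} {p : ℂ × ℂ} (hp : p ∈ flowDomain F) :
    IsFlow F p.1 p.2 (flowMap F p) := by
  rw [flowMap, dif_pos (show ∃ w₁, IsFlow F p.1 p.2 w₁ from hp)]
  exact Exists.choose_spec hp

theorem IsFlow.flowMap_eq {F : ℂ → ℂ} (hF : ContDiff ℂ 1 F) {p : ℂ × ℂ} {w₁ : ℂ}
    (h : IsFlow F p.1 p.2 w₁) : flowMap F p = w₁ :=
  (isFlow_flowMap ⟨_, h⟩).unique hF h

theorem isFlow_iff {F : ℂ → ℂ} (hF : ContDiff ℂ 1 F) {p : ℂ × ℂ} {w₁ : ℂ}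
    (hp : p ∈ flowDomain F) : IsFlow F p.1 p.2 w₁ ↔ w₁ = flowMap F p :=
  ⟨fun h => (h.flowMap_eq hF).symm, fun h => h ▸ isFlow_flowMap hp⟩

/-- The field is given by a polynomial. -/
def IsPolynomialField (F : ℂ → ℂ) : Prop := ∃ P : Polynomial ℂ, F = fun w => P.eval w

theorem IsPolynomialField.contDiff {F : ℂ → ℂ} (hF : IsPolynomialField F) : ContDiff ℂ 1 F := by
  obtain ⟨P, rfl⟩ := hF
  simpa using P.contDiff_aeval (R := ℂ) (𝕜 := ℂ) 1

theorem IsPolynomialField.exists_contDiffAt {F : ℂ → ℂ} (hF : IsPolynomialField F) {p : ℂ × ℂ}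
    (hp : p ∈ flowDomain F) : ∃ g : ℂ × ℂ → ℂ, ContDiffAt ℂ ω g p ∧
      ∀ᶠ q in 𝓝 p, IsFlow F q.1 q.2 (g q) := by
  obtain ⟨P, rfl⟩ := hF
  exact hp.choose_spec.exists_contDiffAt P

theorem isOpen_flowDomain {F : ℂ → ℂ} (hF : IsPolynomialField F) : IsOpen (flowDomain F) :=
  isOpen_iff_mem_nhds.2 fun _ hp =>
    let ⟨_, _, h⟩ := hF.exists_contDiffAt hp
    h.mono fun _ hq => ⟨_, hq⟩

theorem contDiffAt_flowMap {F : ℂ → ℂ} (hF : IsPolynomialField F) {p : ℂ × ℂ}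
    (hp : p ∈ flowDomain F) : ContDiffAt ℂ ω (flowMap F) p := by
  obtain ⟨g, hg, h⟩ := hF.exists_contDiffAt hp
  exact hg.congr_of_eventuallyEq (h.mono fun q hq => hq.flowMap_eq hF.contDiff)

theorem flowMap_zero_left {F : ℂ → ℂ} (hF : ContDiff ℂ 1 F) (w : ℂ) : flowMap F (0, w) = w :=
  IsFlow.flowMap_eq hF
    ⟨fun _ => w, rfl, rfl, fun t _ => by simpa using hasDerivWithinAt_const t _ w⟩

/-- Holomorphy in time is already known, so the complex derivative can be read off along the real
segment from 0 to c; there the chain rule and the flow equation agree up to the common factor c ≠ 0.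
-/
theorem hasDerivAt_flowMap_of_mem_Icc {F : ℂ → ℂ} (hF : IsPolynomialField F) {c w : ℂ}
    (hc : c ≠ 0) (hp : (c, w) ∈ flowDomain F) {t : ℝ} (ht : t ∈ Icc (0 : ℝ) 1) :
    HasDerivAt (fun d => flowMap F (d, w)) (F (flowMap F (t * c, w))) (t * c) := by
  obtain ⟨_, η, h0, h1, h⟩ := id hp
  have hη : ∀ u ∈ Icc (0 : ℝ) 1, flowMap F (u * c, w) = η u := fun u hu =>
    IsFlow.flowMap_eq hF.contDiff (p := (u * c, w)) (by
      have := isFlow_of_mem_Icc h hu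
      rwa [show η 0 = w from h0] at this)
  have hmem : ((t * c, w) : ℂ × ℂ) ∈ flowDomain F := ⟨η t, by
    have := isFlow_of_mem_Icc h ht
    rwa [show η 0 = w from h0] at this⟩
  have hdiff : DifferentiableAt ℂ (fun d => flowMap F (d, w)) (t * c) :=
    ((contDiffAt_flowMap hF hmem).differentiableAt (by simp)).comp (t * c)
      (f := fun d => (d, w)) (by fun_prop)
  have h2 : HasDerivWithinAt (fun u : ℝ => flowMap F (u * c, w))
      (c * deriv (fun d => flowMap F (d, w)) (t * c)) (Icc 0 1) t := by
    have hl : HasDerivAt (fun u : ℝ => (u : ℂ) * c) c t := by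
      simpa using (Complex.ofRealCLM.hasDerivAt (x := t)).mul_const c
    exact (HasDerivAt.scomp t hdiff.hasDerivAt hl).hasDerivWithinAt
  have h3 : HasDerivWithinAt (fun u : ℝ => flowMap F (u * c, w)) (c * F (η t)) (Icc 0 1) t :=
    (h t ht).congr hη (hη t ht)
  have h4 := (uniqueDiffOn_Icc (zero_lt_one' ℝ) t ht).eq_deriv _ h2 h3
  rw [hη t ht, ← mul_left_cancel₀ hc h4]
  exact hdiff.hasDerivAt

/-- The complex time derivative of the flow. -/
theorem hasDerivAt_flowMap {F : ℂ → ℂ} (hF : IsPolynomialField F) {c w : ℂ}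
    (hp : (c, w) ∈ flowDomain F) :
    HasDerivAt (fun d => flowMap F (d, w)) (F (flowMap F (c, w))) c := by
  rcases eq_or_ne c 0 with rfl | hc
  -- At time 0 there is no direction to divide by. As the domain is open, a nonzero time d is
  -- available, and the previous lemma is used at the starting point of its segment.
  · have : ∀ᶠ d : ℂ in 𝓝[≠] 0, (d, w) ∈ flowDomain F := by
      refine nhdsWithin_le_nhds ?_
      exact (by fun_prop : Continuous fun d : ℂ => (d, w)).tendsto 0
        ((isOpen_flowDomain hF).mem_nhds hp)
    obtain ⟨d, hd, hd0⟩ := (this.and self_mem_nhdsWithin).exists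
    simpa using hasDerivAt_flowMap_of_mem_Icc hF hd0 hd (t := 0) (by simp)
  · simpa using hasDerivAt_flowMap_of_mem_Icc hF hc hp (t := 1) (by simp)

/-- The group law of the flow. -/
theorem isFlow_flowMap_add {F : ℂ → ℂ} (hF : IsPolynomialField F) {c d w : ℂ}
    (h : ∀ t ∈ Icc (0 : ℝ) 1, (d + t * c, w) ∈ flowDomain F) :
    IsFlow F c (flowMap F (d, w)) (flowMap F (d + c, w)) := by
  refine ⟨fun t => flowMap F (d + t * c, w), by simp, by simp, fun t ht => ?_⟩
  have hl : HasDerivAt (fun u : ℝ => d + (u : ℂ) * c) c t := by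
    simpa using ((Complex.ofRealCLM.hasDerivAt (x := t)).mul_const c).const_add d
  exact (HasDerivAt.scomp t (hasDerivAt_flowMap hF (h t ht)) hl).hasDerivWithinAt

/-! ### The foliation in the coordinate `w = exp (ζ / 2) * y` -/

/-- The field `w (ε + s w²)(1 - a w²)`. -/
def planarField (s a ε w : ℂ) : ℂ := w * radial s a ε (w ^ 2)

theorem isPolynomialField_planarField (s a ε : ℂ) : IsPolynomialField (planarField s a ε) :=
  ⟨.X * ((.C ε + .C s * .X ^ 2) * (1 - .C a * .X ^ 2)), by
    ext w; simp [planarField, radial]⟩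

theorem contDiff_planarField (s a ε : ℂ) : ContDiff ℂ 1 (planarField s a ε) :=
  (isPolynomialField_planarField s a ε).contDiff

theorem hasDerivWithinAt_exp_segment (k ζ₀ ζ₁ : ℂ) (S : Set ℝ) (t : ℝ) :
    HasDerivWithinAt (fun t : ℝ => Complex.exp (k * (ζ₀ + t * (ζ₁ - ζ₀))))
      (Complex.exp (k * (ζ₀ + t * (ζ₁ - ζ₀))) * (k * (ζ₁ - ζ₀))) S t := by
  have : HasDerivAt (fun t : ℝ => k * (ζ₀ + (t : ℂ) * (ζ₁ - ζ₀))) (k * (ζ₁ - ζ₀)) t := by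
    simpa using
      (((Complex.ofRealCLM.hasDerivAt (x := t)).mul_const (ζ₁ - ζ₀)).const_add ζ₀).const_mul k
  exact this.cexp.hasDerivWithinAt

/-- Differentiating e^{ζ/2} contributes w/2 = i w/(2i), which cancels the -i of the y-equation; the
remaining equation is autonomous because e^ζ y² = w². -/
theorem isHolonomy_iff {s a ε ζ₀ ζ₁ y₀ y₁ : ℂ} : IsHolonomy s a ε ζ₀ ζ₁ y₀ y₁ ↔
    IsFlow (planarField s a ε) ((ζ₁ - ζ₀) / (2 * Complex.I)) (Complex.exp (ζ₀ / 2) * y₀)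
      (Complex.exp (ζ₁ / 2) * y₁) := by
  have hI : (2 : ℂ) * Complex.I ≠ 0 := by simp
  have he : ∀ z : ℂ, Complex.exp (1 / 2 * z) ^ 2 = Complex.exp z := fun z => by
    rw [← Complex.exp_nat_mul]; congr 1; push_cast; ring
  have he' : ∀ z : ℂ, Complex.exp (-(1 / 2) * z) * Complex.exp (1 / 2 * z) = 1 := fun z => by
    rw [← Complex.exp_add, ← add_mul, neg_add_cancel, zero_mul, Complex.exp_zero]
  constructor
  · rintro ⟨η, h0, h1, h⟩
    refine ⟨fun t => Complex.exp (1 / 2 * (ζ₀ + t * (ζ₁ - ζ₀))) * η t, ?_, ?_, fun t ht => ?_⟩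
    · simp [h0, div_eq_inv_mul]
    · simp [h1, div_eq_inv_mul]
    · convert! (hasDerivWithinAt_exp_segment (1 / 2) ζ₀ ζ₁ _ t).mul (h t ht) using 1
      simp only [planarField, liftedField, mul_pow, he]
      field_simp
      ring
  · rintro ⟨w, h0, h1, h⟩
    refine ⟨fun t => Complex.exp (-(1 / 2) * (ζ₀ + t * (ζ₁ - ζ₀))) * w t, ?_, ?_, fun t ht => ?_⟩
    · have := he' ζ₀
      rw [show 1 / 2 * ζ₀ = ζ₀ / 2 by ring] at this
      simp only [h0, Complex.ofReal_zero, zero_mul, add_zero]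
      rw [← mul_assoc, this, one_mul]
    · have := he' ζ₁
      rw [show 1 / 2 * ζ₁ = ζ₁ / 2 by ring] at this
      simp only [h1, Complex.ofReal_one, one_mul, add_sub_cancel]
      rw [← mul_assoc, this, one_mul]
    · convert! (hasDerivWithinAt_exp_segment (-(1 / 2)) ζ₀ ζ₁ _ t).mul (h t ht) using 1
      have h1 : Complex.exp (ζ₀ + t * (ζ₁ - ζ₀)) *
          (Complex.exp (-(1 / 2) * (ζ₀ + t * (ζ₁ - ζ₀))) * w t) ^ 2 = w t ^ 2 := by
        rw [← he, mul_pow, ← mul_assoc, ← mul_pow, mul_comm (Complex.exp _), he', one_pow, one_mul]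
      simp only [planarField, liftedField, h1]
      field_simp

theorem isSemiMonodromy_iff {s a ε x z : ℂ} :
    IsSemiMonodromy s a ε x z ↔ IsFlow (planarField s a ε) Real.pi x (-z) := by
  have hpi := Real.pi_pos
  constructor
  · rintro ⟨w, h0, h1, h⟩
    refine ⟨fun t => w (Real.pi * t), by simpa using h0, by simp [h1], fun t ht => ?_⟩
    have hm : ∀ t ∈ Icc (0 : ℝ) 1, Real.pi * t ∈ Icc 0 Real.pi := fun t ht =>
      ⟨mul_nonneg hpi.le ht.1, mul_le_of_le_one_right hpi.le ht.2⟩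
    have hd : HasDerivWithinAt (fun t : ℝ => Real.pi * t) Real.pi (Icc 0 1) t := by
      simpa using ((hasDerivAt_id t).const_mul Real.pi).hasDerivWithinAt
    have := (h _ (hm t ht)).scomp t hd hm
    convert! this using 1
  · rintro ⟨w, h0, h1, h⟩
    refine ⟨fun t => w (t / Real.pi), by simpa using h0,
      by simp [h1], fun t ht => ?_⟩
    have hm : ∀ t ∈ Icc 0 Real.pi, t / Real.pi ∈ Icc (0 : ℝ) 1 := fun t ht =>
      ⟨div_nonneg ht.1 hpi.le, (div_le_one hpi).2 ht.2⟩
    have hd : HasDerivWithinAt (fun t : ℝ => t / Real.pi) (1 / Real.pi) (Icc 0 Real.pi) t := by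
      simpa using ((hasDerivAt_id t).div_const Real.pi).hasDerivWithinAt
    have := (h _ (hm t ht)).scomp t hd hm
    convert! this using 1
    simp [planarField, hpi.ne']

/-! ### The standing assumptions -/

/-- Bounds, on the disks of radius `R` and `2 R`, that make the sealing by `f` of the covering
over the bidisk of radius `r` well defined. -/
structure IsSealable (s a ε : ℂ) (f : ℂ → ℂ) (R r : ℝ) : Prop where
  r_pos : 0 < r
  -- Labels stay below 5r, with room for a further passage along the leaf, and `f` at most doubles
  -- them; 10r must not exceed R.
  r_le : 16 * r ≤ R
  norm_radial_le : ∀ w : ℂ, ‖w‖ ≤ 2 * R → ‖radial s a ε (w ^ 2)‖ ≤ 1 / 8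
  contDiffAt : ∀ x ∈ ball (0 : ℂ) R, ContDiffAt ℂ ω f x
  deriv_ne_zero : ∀ x ∈ ball (0 : ℂ) R, deriv f x ≠ 0
  injOn : InjOn f (ball 0 R)
  norm_le : ∀ x ∈ ball (0 : ℂ) R, ‖f x‖ ≤ 2 * ‖x‖

variable {s a ε : ℂ} {f : ℂ → ℂ} {R r : ℝ}

theorem IsSealable.exists_isFlow (h : IsSealable s a ε f R r) {c w : ℂ}
    (hw : ‖w‖ * Real.exp (‖c‖ / 8) ≤ R) : ∃ w₁, IsFlow (planarField s a ε) c w w₁ ∧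
      ‖w₁‖ ≤ ‖w‖ * Real.exp (‖c‖ / 8) := by
  have he : 1 / 8 * ‖c‖ = ‖c‖ / 8 := by ring
  have := WeakFocus.exists_isFlow (contDiff_planarField s a ε) (κ := 1 / 8) (R := R) (c := c)
    (w := w) (by norm_num) (by linarith [h.r_pos, h.r_le]) (fun z hz => by
      rw [planarField, norm_mul, mul_comm]
      exact mul_le_mul_of_nonneg_right (h.norm_radial_le z hz) (norm_nonneg z)) (by rwa [he])
  rwa [he] at this

theorem IsSealable.mem_flowDomain (h : IsSealable s a ε f R r) {c w : ℂ}
    (hw : ‖w‖ * Real.exp (‖c‖ / 8) ≤ R) : (c, w) ∈ flowDomain (planarField s a ε) :=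
  let ⟨_, h, _⟩ := h.exists_isFlow hw
  ⟨_, h⟩

theorem IsSealable.norm_flowMap_le (h : IsSealable s a ε f R r) {c w : ℂ}
    (hw : ‖w‖ * Real.exp (‖c‖ / 8) ≤ R) :
    ‖flowMap (planarField s a ε) (c, w)‖ ≤ ‖w‖ * Real.exp (‖c‖ / 8) := by
  obtain ⟨w₁, h₁, hb⟩ := h.exists_isFlow hw
  rwa [IsFlow.flowMap_eq (contDiff_planarField s a ε) (p := (c, w)) h₁]

/-! ### The label of a leaf -/

/-- The label of the leaf through `(ζ, y)`: the point where it meets the fibre over `0`. -/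
def label (s a ε : ℂ) (p : ℂ × ℂ) : ℂ :=
  flowMap (planarField s a ε) (-(p.1 / (2 * Complex.I)), Complex.exp (p.1 / 2) * p.2)

/-- The point over `ζ` of the leaf with label `x`. -/
def leafPt (s a ε : ℂ) (q : ℂ × ℂ) : ℂ :=
  Complex.exp (-(q.1 / 2)) * flowMap (planarField s a ε) (q.1 / (2 * Complex.I), q.2)

/-- Here |w| equals both |y| e^{Re ζ/2} and |x| e^{-Re ζ/2}; using whichever is better gives the
decay that pays for the long holonomy times. -/
theorem norm_exp_half_mul_lt {p : ℂ × ℂ} (hp : p ∈ coverDomain r) :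
    ‖Complex.exp (p.1 / 2) * p.2‖ < r * Real.exp (-(|p.1.re| / 2)) := by
  obtain ⟨-, -, h1, h2⟩ := hp
  have hre : (p.1 / 2).re = p.1.re / 2 := by simp
  rw [norm_mul, Complex.norm_exp] at h2 ⊢
  rw [hre]
  rcases abs_cases p.1.re with ⟨h, -⟩ | ⟨h, -⟩ <;> rw [h]
  · have : Real.exp (p.1.re / 2) * ‖p.2‖ =
        Real.exp p.1.re * ‖p.2‖ * Real.exp (-(p.1.re / 2)) := by
      rw [mul_right_comm, ← Real.exp_add]; congr 2; ring
    rw [this]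
    gcongr
  · rw [mul_comm, show -(-p.1.re / 2) = p.1.re / 2 by ring]
    gcongr

theorem norm_div_two_I_le {z : ℂ} (h : |z.im| ≤ 8) :
    ‖z / (2 * Complex.I)‖ ≤ |z.re| / 2 + 4 := by
  have : ‖z / (2 * Complex.I)‖ = ‖z‖ / 2 := by simp
  have := Complex.norm_le_abs_re_add_abs_im z
  linarith

/-- The segments in use join the covering to fibres over the points 2πit with t in [0, 1], so
imaginary parts differ by less than 9π/4 < 8. -/
theorem abs_im_sub_le {p : ℂ × ℂ} (hp : p ∈ coverDomain r) {t : ℝ} (ht : t ∈ Icc (0 : ℝ) 1) :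
    |p.1.im - 2 * Real.pi * t| ≤ 8 := by
  obtain ⟨h1, h2, -⟩ := hp
  have h3 := Real.pi_lt_d2
  have h4 := Real.pi_pos
  have h5 : 0 ≤ Real.pi * t := mul_nonneg h4.le ht.1
  have h6 : Real.pi * t ≤ Real.pi := mul_le_of_le_one_right h4.le ht.2
  rw [abs_le]
  constructor <;> linarith

theorem abs_im_le {p : ℂ × ℂ} (hp : p ∈ coverDomain r) : |p.1.im| ≤ 8 := by
  simpa using abs_im_sub_le hp (t := 0) (by simp)

theorem exp_one_le_three : Real.exp 1 ≤ 3 := by linarith [Real.exp_one_lt_d9]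

/-- Along the leaves through the covering, the coordinate `w` stays small for as long as needed. -/
theorem mul_exp_lt {x k b c : ℝ} (hr : 0 < r) (hx : 0 ≤ x) (hb : b < k * r * Real.exp (-(x / 2)))
    (hk : 0 ≤ k) (hc : c ≤ 3 * (x / 16 + 1 / 2)) : b * Real.exp c < 5 * k * r := by
  have h1 : Real.exp (3 / 2) < 5 := by
    have h := Real.exp_one_lt_d9
    have h2 : Real.exp (3 / 2) ^ 2 = Real.exp 1 ^ 3 := by
      rw [← Real.exp_nat_mul, ← Real.exp_nat_mul]; norm_num
    have h3 : Real.exp 1 ^ 3 < 25 :=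
      (pow_lt_pow_left₀ h (Real.exp_pos _).le (by norm_num)).trans (by norm_num)
    nlinarith [Real.exp_pos (3 / 2)]
  have hkr : 0 ≤ k * r := by positivity
  calc b * Real.exp c < k * r * Real.exp (-(x / 2)) * Real.exp c := by gcongr
    _ = k * r * Real.exp (-(x / 2) + c) := by rw [mul_assoc, ← Real.exp_add]
    -- A passage of time at most x/2 + 4 at growth rate 1/8 costs exp(x/16 + 1/2). Three passages
    -- are budgeted, and 3x/16 is absorbed by the decay exp(-x/2).
    _ ≤ k * r * Real.exp (3 / 2) := by gcongr; linarith
    _ ≤ k * r * 5 := by gcongr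
    _ = 5 * k * r := by ring

theorem IsSealable.mem_flowDomain_of_mem (h : IsSealable s a ε f R r) {p : ℂ × ℂ}
    (hp : p ∈ coverDomain r) {c : ℂ} (hc : ‖c‖ ≤ |p.1.re| / 2 + 4) :
    (c, Complex.exp (p.1 / 2) * p.2) ∈ flowDomain (planarField s a ε) := by
  refine h.mem_flowDomain (le_trans (mul_exp_lt h.r_pos (abs_nonneg p.1.re) (k := 1) (by
    simpa using norm_exp_half_mul_lt hp) zero_le_one ?_).le (by linarith [h.r_le, h.r_pos]))
  have := abs_nonneg p.1.re
  linarith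

/-- Reaching the label spends one of the three budgeted passages; the exponent `c` leaves room for
two more. -/
theorem IsSealable.norm_label_mul_exp_lt (h : IsSealable s a ε f R r) {p : ℂ × ℂ}
    (hp : p ∈ coverDomain r) {c : ℝ} (hc : c ≤ 2 * (|p.1.re| / 16 + 1 / 2)) :
    ‖label s a ε p‖ * Real.exp c < 5 * r := by
  have hn := norm_div_two_I_le (abs_im_le hp)
  rw [← norm_neg] at hn
  have hx := abs_nonneg p.1.re
  have hw := norm_exp_half_mul_lt hp
  have key : ∀ d : ℝ, d ≤ 3 * (|p.1.re| / 16 + 1 / 2) →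
      ‖Complex.exp (p.1 / 2) * p.2‖ * Real.exp d < 5 * r := fun d hd => by
    simpa using mul_exp_lt h.r_pos hx (k := 1) (by simpa using hw) zero_le_one hd
  have h1 := h.norm_flowMap_le (c := -(p.1 / (2 * Complex.I))) (w := Complex.exp (p.1 / 2) * p.2)
    ((key _ (by linarith)).le.trans (by linarith [h.r_le, h.r_pos]))
  refine (mul_le_mul_of_nonneg_right h1 (Real.exp_pos _).le).trans_lt ?_
  rw [mul_assoc, ← Real.exp_add]
  exact key _ (by linarith)

theorem IsSealable.label_mem_ball (h : IsSealable s a ε f R r) {p : ℂ × ℂ}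
    (hp : p ∈ coverDomain r) : label s a ε p ∈ ball (0 : ℂ) R := by
  have := h.norm_label_mul_exp_lt hp (c := 0) (by positivity)
  rw [Real.exp_zero, mul_one] at this
  rw [mem_ball_zero_iff]
  linarith [h.r_le, h.r_pos]

theorem IsSealable.isFlow_label (h : IsSealable s a ε f R r) {p : ℂ × ℂ}
    (hp : p ∈ coverDomain r) : IsFlow (planarField s a ε) (-(p.1 / (2 * Complex.I)))
      (Complex.exp (p.1 / 2) * p.2) (label s a ε p) :=
  isFlow_flowMap (h.mem_flowDomain_of_mem hp (by
    rw [norm_neg]; exact norm_div_two_I_le (abs_im_le hp)))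

/-- The sealing map in terms of labels of leaves. -/
theorem IsSealable.isSealed_iff (h : IsSealable s a ε f R r) {p q : ℂ × ℂ}
    (hp : p ∈ coverDomain r) : IsSealed s a ε f p q ↔ p.1 ∈ flapEnd ∧
      q.1 = p.1 - 2 * Real.pi * Complex.I ∧ IsFlow (planarField s a ε)
        (-(q.1 / (2 * Complex.I))) (Complex.exp (q.1 / 2) * q.2) (f (label s a ε p)) := by
  set F := planarField s a ε with hF
  have hFc : ContDiff ℂ 1 F := contDiff_planarField s a ε
  have hFp : IsPolynomialField F := isPolynomialField_planarField s a ε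
  set w := Complex.exp (p.1 / 2) * p.2 with hw
  set d : ℂ := (2 * Real.pi * Complex.I - p.1) / (2 * Complex.I) with hd
  have hdeq : d = Real.pi - p.1 / (2 * Complex.I) := by
    rw [hd]; field_simp
  -- These are the times from p to the fibres over 2πi(1 - t), so the group law can be applied along
  -- the whole segment from 2πi down to 0.
  have hdom : ∀ t ∈ Icc (0 : ℝ) 1, (d + t * (-Real.pi), w) ∈ flowDomain F := fun t ht => by
    refine h.mem_flowDomain_of_mem hp ?_
    have h1 : d + t * (-Real.pi) =
        -((p.1 - ((2 * Real.pi * (1 - t) : ℝ) : ℂ) * Complex.I) / (2 * Complex.I)) := by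
      rw [hdeq]; push_cast; field_simp; ring
    rw [h1, norm_neg]
    refine (norm_div_two_I_le ?_).trans (by simp)
    have := abs_im_sub_le hp (t := 1 - t) ⟨by linarith [ht.2], by linarith [ht.1]⟩
    simpa using this
  have hd0 : (d, w) ∈ flowDomain F := by simpa using hdom 0 (by simp)
  -- Undoing the time π flow after the holonomy to 2πi is the holonomy to 0: thus Q₀⁻¹ ∘ h is the
  -- label.
  have hlab : IsFlow F (-Real.pi) (flowMap F (d, w)) (label s a ε p) := by
    have := isFlow_flowMap_add hFp hdom
    convert this using 2
    rw [label, ← hF, ← hw, hdeq]; congr 2; ring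
  -- Over 2πi the coordinates w and y differ by e^{πi} = -1, which cancels the sign L₋₁ of Q₀.
  have hexp : ∀ z : ℂ, Complex.exp (2 * Real.pi * Complex.I / 2) * z = -z := fun z => by
    rw [show (2 * Real.pi * Complex.I / 2 : ℂ) = Real.pi * Complex.I by ring,
      Complex.exp_pi_mul_I, neg_one_mul]
  have hz0 : ∀ z' : ℂ, IsHolonomy s a ε q.1 0 q.2 z' ↔ IsFlow F
      (-(q.1 / (2 * Complex.I))) (Complex.exp (q.1 / 2) * q.2) z' := fun z' => by
    rw [isHolonomy_iff, zero_sub, neg_div, zero_div, Complex.exp_zero, one_mul]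
  constructor
  · rintro ⟨h1, -, h3, z, z', hz, ⟨x, hx, rfl⟩, hz'⟩
    rw [isHolonomy_iff, hexp] at hz
    rw [isSemiMonodromy_iff] at hx
    rw [hz0] at hz'
    have e1 : -z = flowMap F (d, w) := (isFlow_iff hFc hd0).1 hz
    rw [e1] at hx
    rw [← hx.symm.unique hFc hlab]
    exact ⟨h1, h3, hz'⟩
  · rintro ⟨h1, h3, hz'⟩
    refine ⟨h1, ?_, h3, -flowMap F (d, w), f (label s a ε p), ?_, ⟨label s a ε p, ?_, rfl⟩, ?_⟩
    · obtain ⟨h4, h5⟩ := h1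
      rw [h3]
      constructor <;> simp <;> linarith
    · rw [isHolonomy_iff, hexp, neg_neg]
      exact isFlow_flowMap hd0
    · rw [isSemiMonodromy_iff, neg_neg]
      exact isFlow_neg_iff.1 hlab
    · rwa [hz0]

theorem mul_exp_half_cancel (z y : ℂ) : Complex.exp (z / 2) * (Complex.exp (-(z / 2)) * y) = y := by
  rw [← mul_assoc, ← Complex.exp_add, add_neg_cancel, Complex.exp_zero, one_mul]

theorem mul_exp_neg_half_cancel (z y : ℂ) :
    Complex.exp (-(z / 2)) * (Complex.exp (z / 2) * y) = y := by
  rw [← mul_assoc, ← Complex.exp_add, neg_add_cancel, Complex.exp_zero, one_mul]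

/-- The image is the point over ζ - 2πi of the leaf with label `f (label p)`. That leaf reaches the
required fibre because the decay in |Re ζ| still covers this second passage after doubling by `f`.
-/
theorem IsSealable.existsUnique_isSealed (h : IsSealable s a ε f R r) {p : ℂ × ℂ}
    (hp : p ∈ coverDomain r) (hpe : p.1 ∈ flapEnd) : ∃! q : ℂ × ℂ, IsSealed s a ε f p q := by
  have hFc := contDiff_planarField s a ε
  set ζ' := p.1 - 2 * Real.pi * Complex.I with hζ'
  have hre : ζ'.re = p.1.re := by simp [hζ']
  have hn : ‖ζ' / (2 * Complex.I)‖ ≤ |p.1.re| / 2 + 4 := by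
    rw [← hre]
    refine norm_div_two_I_le ?_
    simpa [hζ'] using abs_im_sub_le hp (t := 1) (by simp)
  have hdom : (ζ' / (2 * Complex.I), f (label s a ε p)) ∈ flowDomain (planarField s a ε) := by
    refine h.mem_flowDomain ?_
    have h1 := h.norm_le _ (h.label_mem_ball hp)
    have hx := abs_nonneg p.1.re
    have h2 := h.norm_label_mul_exp_lt hp (c := ‖ζ' / (2 * Complex.I)‖ / 8) (by linarith)
    have h3 := mul_le_mul_of_nonneg_right h1 (Real.exp_pos (‖ζ' / (2 * Complex.I)‖ / 8)).le
    linarith [h.r_le, h.r_pos]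
  refine ⟨(ζ', Complex.exp (-(ζ' / 2)) *
    flowMap (planarField s a ε) (ζ' / (2 * Complex.I), f (label s a ε p))), ?_, fun q hq => ?_⟩
  · refine (h.isSealed_iff hp).2 ⟨hpe, rfl, ?_⟩
    rw [mul_exp_half_cancel]
    exact (isFlow_flowMap hdom).symm
  · obtain ⟨-, h1, h2⟩ := (h.isSealed_iff hp).1 hq
    rw [h1] at h2
    have := (isFlow_iff hFc hdom).1 (isFlow_neg_iff.1 h2)
    refine Prod.ext h1 ?_
    rw [← this, mul_exp_neg_half_cancel]

/-! ### Rectifying coordinates on the covering -/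

/-- The pairs `(ζ, x)` for which the leaf with label `x` is known to extend to the fibre over `ζ`
within the disk of radius `R`. -/
def leafDomain (R : ℝ) : Set (ℂ × ℂ) :=
  {q | ‖q.2‖ * Real.exp (‖q.1 / (2 * Complex.I)‖ / 8) < R}

theorem isOpen_leafDomain (R : ℝ) : IsOpen (leafDomain R) :=
  isOpen_lt (by fun_prop) continuous_const

theorem contDiff_flow_arg : ContDiff ℂ ω fun p : ℂ × ℂ =>
    ((-(p.1 / (2 * Complex.I)), Complex.exp (p.1 / 2) * p.2) : ℂ × ℂ) := by
  simp only [div_eq_mul_inv]; fun_prop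

theorem IsSealable.contDiffAt_label (h : IsSealable s a ε f R r) {p : ℂ × ℂ}
    (hp : p ∈ coverDomain r) : ContDiffAt ℂ ω (label s a ε) p :=
  ContDiffAt.comp p (contDiffAt_flowMap (isPolynomialField_planarField s a ε)
    ⟨_, h.isFlow_label hp⟩) contDiff_flow_arg.contDiffAt

theorem IsSealable.isFlow_leafPt (h : IsSealable s a ε f R r) {q : ℂ × ℂ}
    (hq : q ∈ leafDomain R) : IsFlow (planarField s a ε) (q.1 / (2 * Complex.I)) q.2
      (Complex.exp (q.1 / 2) * leafPt s a ε q) := by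
  rw [leafPt, mul_exp_half_cancel]
  exact isFlow_flowMap (h.mem_flowDomain (le_of_lt hq))

theorem IsSealable.contDiffAt_leafPt (h : IsSealable s a ε f R r) {q : ℂ × ℂ}
    (hq : q ∈ leafDomain R) : ContDiffAt ℂ ω (leafPt s a ε) q := by
  have h1 : ContDiffAt ℂ ω (fun q : ℂ × ℂ =>
      flowMap (planarField s a ε) (q.1 / (2 * Complex.I), q.2)) q :=
    ContDiffAt.comp q (f := fun q : ℂ × ℂ => (q.1 / (2 * Complex.I), q.2))
      (contDiffAt_flowMap (isPolynomialField_planarField s a ε)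
      (h.mem_flowDomain (le_of_lt hq))) (by simp only [div_eq_mul_inv]; fun_prop)
  have h2 : ContDiffAt ℂ ω (fun q : ℂ × ℂ => Complex.exp (-(q.1 / 2))) q := by
    simp only [div_eq_mul_inv]; fun_prop
  exact h2.mul h1

theorem IsSealable.label_eq_iff (h : IsSealable s a ε f R r) {p : ℂ × ℂ}
    (hp : p ∈ coverDomain r) {x : ℂ} : label s a ε p = x ↔
      IsFlow (planarField s a ε) (-(p.1 / (2 * Complex.I))) (Complex.exp (p.1 / 2) * p.2) x :=
  ⟨fun hx => hx ▸ h.isFlow_label hp,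
    fun hx => (h.isFlow_label hp).unique (contDiff_planarField s a ε) hx⟩

theorem IsSealable.label_mem_leafDomain (h : IsSealable s a ε f R r) {p : ℂ × ℂ}
    (hp : p ∈ coverDomain r) : (p.1, label s a ε p) ∈ leafDomain R := by
  have hx := abs_nonneg p.1.re
  have hn := norm_div_two_I_le (abs_im_le hp)
  refine (h.norm_label_mul_exp_lt hp (by linarith)).trans_le ?_
  linarith [h.r_le, h.r_pos]

theorem IsSealable.leafPt_label (h : IsSealable s a ε f R r) {p : ℂ × ℂ}
    (hp : p ∈ coverDomain r) : leafPt s a ε (p.1, label s a ε p) = p.2 := by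
  have h1 := (isFlow_neg_iff.1 (h.isFlow_label hp)).unique (contDiff_planarField s a ε)
    (h.isFlow_leafPt (h.label_mem_leafDomain hp))
  exact (mul_left_cancel₀ (Complex.exp_ne_zero _) h1).symm

theorem IsSealable.label_leafPt (h : IsSealable s a ε f R r) {q : ℂ × ℂ}
    (hq : q ∈ leafDomain R) (hp : (q.1, leafPt s a ε q) ∈ coverDomain r) :
    label s a ε (q.1, leafPt s a ε q) = q.2 :=
  (h.label_eq_iff hp).2 (h.isFlow_leafPt hq).symm

/-- The rectifying chart `(ζ, y) ↦ (ζ, label)`. -/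
def rectify (h : IsSealable s a ε f R r) : OpenPartialHomeomorph (ℂ × ℂ) (ℂ × ℂ) where
  toFun p := (p.1, label s a ε p)
  invFun q := (q.1, leafPt s a ε q)
  source := coverDomain r
  target := leafDomain R ∩ (fun q => (q.1, leafPt s a ε q)) ⁻¹' coverDomain r
  map_source' p hp := ⟨h.label_mem_leafDomain hp, by
    simp only [mem_preimage, h.leafPt_label hp]; exact hp⟩
  map_target' q hq := hq.2
  left_inv' p hp := by simp only [h.leafPt_label hp]
  right_inv' q hq := Prod.ext rfl (h.label_leafPt hq.1 hq.2)
  open_source := (coverDomain r).isOpen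
  open_target := ContinuousOn.isOpen_inter_preimage (fun q hq =>
    (continuousAt_fst.prodMk (h.contDiffAt_leafPt hq).continuousAt).continuousWithinAt)
      (isOpen_leafDomain R) (coverDomain r).isOpen
  continuousOn_toFun p hp :=
    (continuousAt_fst.prodMk (h.contDiffAt_label hp).continuousAt).continuousWithinAt
  continuousOn_invFun q hq :=
    (continuousAt_fst.prodMk (h.contDiffAt_leafPt hq.1).continuousAt).continuousWithinAt

theorem contDiffOn_rectify (h : IsSealable s a ε f R r) :
    ContDiffOn ℂ ω (rectify h) (rectify h).source := fun _ hp =>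
  (contDiffAt_fst.prodMk (h.contDiffAt_label hp)).contDiffWithinAt

theorem contDiffOn_rectify_symm (h : IsSealable s a ε f R r) :
    ContDiffOn ℂ ω (rectify h).symm (rectify h).target := fun _ hq =>
  (contDiffAt_fst.prodMk (h.contDiffAt_leafPt hq.1)).contDiffWithinAt

/-- With ζ = ζ₀ + 2it the flow time advances by t: the exponential factor produces the term -i of
the field, and the planar flow produces the radial term. -/
theorem IsSealable.hasDerivAt_leafPt (h : IsSealable s a ε f R r) {q : ℂ × ℂ}
    (hq : q ∈ leafDomain R) : HasDerivAt (fun t : ℂ => leafPt s a ε (q.1 + 2 * Complex.I * t, q.2))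
      (liftedField s a ε (q.1, leafPt s a ε q)).2 0 := by
  have hd := hasDerivAt_flowMap (isPolynomialField_planarField s a ε)
    (h.mem_flowDomain (le_of_lt hq))
  have hl : HasDerivAt (fun t : ℂ => (q.1 + 2 * Complex.I * t) / (2 * Complex.I)) 1 0 := by
    have := (((hasDerivAt_id (0 : ℂ)).const_mul (2 * Complex.I)).const_add q.1).div_const
      (2 * Complex.I)
    simpa using this
  have he : HasDerivAt (fun t : ℂ => Complex.exp (-((q.1 + 2 * Complex.I * t) / 2)))
      (Complex.exp (-(q.1 / 2)) * -Complex.I) 0 := by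
    have := (((((hasDerivAt_id (0 : ℂ)).const_mul (2 * Complex.I)).const_add q.1).div_const
      2).neg).cexp
    simpa using this
  have hd' : HasDerivAt (fun t : ℂ => flowMap (planarField s a ε)
      ((q.1 + 2 * Complex.I * t) / (2 * Complex.I), q.2))
      (planarField s a ε (flowMap (planarField s a ε) (q.1 / (2 * Complex.I), q.2)) * 1) 0 :=
    HasDerivAt.comp (h₂ := fun d => flowMap (planarField s a ε) (d, q.2)) 0
      (by simpa using hd) hl
  convert! he.mul hd' using 1
  have h1 : Complex.exp q.1 * leafPt s a ε q ^ 2 =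
      flowMap (planarField s a ε) (q.1 / (2 * Complex.I), q.2) ^ 2 := by
    rw [leafPt, mul_pow, ← mul_assoc, ← Complex.exp_nat_mul, ← Complex.exp_add]
    have : q.1 + (2 : ℕ) * -(q.1 / 2) = 0 := by push_cast; ring
    rw [this, Complex.exp_zero, one_mul]
  change leafPt s a ε q * (-Complex.I + radial s a ε (Complex.exp q.1 * leafPt s a ε q ^ 2)) = _
  rw [h1, planarField, leafPt]
  simp only [mul_zero, add_zero]
  ring

/-- In the rectifying chart the lifted field is the constant field `(2 i, 0)`. -/
theorem fderiv_rectify_liftedField (h : IsSealable s a ε f R r) {p : ℂ × ℂ}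
    (hp : p ∈ coverDomain r) :
    fderiv ℂ (rectify h) p (liftedField s a ε p) = (2 * Complex.I, 0) := by
  have hdiff : DifferentiableAt ℂ (rectify h) p :=
    ((contDiffOn_rectify h).differentiableOn (by simp)).differentiableAt
      ((rectify h).open_source.mem_nhds hp)
  set x := label s a ε p with hx
  have hq : (p.1, x) ∈ leafDomain R := h.label_mem_leafDomain hp
  have hlp : leafPt s a ε (p.1, x) = p.2 := h.leafPt_label hp
  have hl : HasDerivAt (fun t : ℂ => p.1 + 2 * Complex.I * t) (2 * Complex.I) 0 := by
    simpa using ((hasDerivAt_id (0 : ℂ)).const_mul (2 * Complex.I)).const_add p.1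
  -- The trajectory through p keeps its label x, so the chart maps it to the straight line t ↦ (ζ +
  -- 2it, x); the two computations of its velocity are compared.
  have hc : HasDerivAt
      (fun t : ℂ => (p.1 + 2 * Complex.I * t, leafPt s a ε (p.1 + 2 * Complex.I * t, x)))
      (liftedField s a ε p) 0 := by
    have := h.hasDerivAt_leafPt hq
    rw [hlp] at this
    exact hl.prodMk this
  have h0 : (p.1 + 2 * Complex.I * 0, leafPt s a ε (p.1 + 2 * Complex.I * 0, x)) = p := by
    rw [mul_zero, add_zero, hlp]
  have h1 : HasDerivAt (fun t : ℂ => rectify h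
      (p.1 + 2 * Complex.I * t, leafPt s a ε (p.1 + 2 * Complex.I * t, x)))
      (fderiv ℂ (rectify h) p (liftedField s a ε p)) 0 :=
    HasFDerivAt.comp_hasDerivAt (0 : ℂ) (by rw [h0]; exact hdiff.hasFDerivAt) hc
  have h2 : HasDerivAt (fun t : ℂ => (p.1 + 2 * Complex.I * t, x)) (2 * Complex.I, 0) 0 :=
    hl.prodMk (hasDerivAt_const _ _)
  refine h1.unique (h2.congr_of_eventuallyEq ?_)
  have hopen := (rectify h).open_target
  have hmem : (p.1, x) ∈ (rectify h).target := (rectify h).map_source hp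
  have hcont : Continuous fun t : ℂ => (p.1 + 2 * Complex.I * t, x) := by fun_prop
  have := hcont.tendsto 0
  simp only [mul_zero, add_zero] at this
  filter_upwards [this (hopen.mem_nhds hmem)] with t ht
  exact (rectify h).right_inv ht

/-- The sealing map on the covering, in the rectifying chart. -/
theorem IsSealable.isSealed_iff_label (h : IsSealable s a ε f R r) {p q : ℂ × ℂ}
    (hp : p ∈ coverDomain r) (hq : q ∈ coverDomain r) : IsSealed s a ε f p q ↔
      q.1 = p.1 - 2 * Real.pi * Complex.I ∧ label s a ε q = f (label s a ε p) := by
  rw [h.isSealed_iff hp, ← h.label_eq_iff hq]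
  -- Lying over the end flap is automatic: p is 2π above a point of the covering, whose imaginary
  -- part exceeds -π/4.
  refine ⟨fun h => h.2, fun h => ⟨⟨?_, hp.2.1⟩, h⟩⟩
  have h1 := congrArg Complex.im h.1
  have h2 := hq.1
  simp at h1
  linarith

/-! ### The chart of the covering and the gluing map -/

theorem IsSealable.nonempty (h : IsSealable s a ε f R r) : Nonempty (coverDomain r) :=
  ⟨⟨(0, 0), by
    have hpi := Real.pi_pos
    have hr := h.r_pos
    refine ⟨?_, ?_, ?_, ?_⟩ <;> simp <;> positivity⟩⟩

/-- The rectifying chart on the covering. -/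
def coverChart (h : IsSealable s a ε f R r) : OpenPartialHomeomorph (coverDomain r) (ℂ × ℂ) :=
  ((coverDomain r).openPartialHomeomorphSubtypeCoe h.nonempty).trans (rectify h)

theorem coverChart_source (h : IsSealable s a ε f R r) : (coverChart h).source = univ := by
  ext p
  simp [coverChart]
  exact p.2

theorem mem_coverChart_source (h : IsSealable s a ε f R r) (p : coverDomain r) :
    p ∈ (coverChart h).source := by rw [coverChart_source]; trivial

theorem coverChart_apply (h : IsSealable s a ε f R r) (p : coverDomain r) :
    coverChart h p = (p.1.1, label s a ε p.1) := rfl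

theorem continuous_coverChart (h : IsSealable s a ε f R r) : Continuous (coverChart h) := by
  have := (coverChart h).continuousOn
  rwa [coverChart_source, continuousOn_univ] at this

theorem coverChart_injective (h : IsSealable s a ε f R r) : Function.Injective (coverChart h) :=
  fun p q hpq => (coverChart h).injOn (mem_coverChart_source h p) (mem_coverChart_source h q) hpq

theorem coverChart_symm_apply (h : IsSealable s a ε f R r) (p : coverDomain r) :
    (coverChart h).symm (coverChart h p) = p :=
  (coverChart h).left_inv (mem_coverChart_source h p)

theorem coverChart_snd_mem (h : IsSealable s a ε f R r) (p : coverDomain r) :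
    (coverChart h p).2 ∈ ball (0 : ℂ) R := h.label_mem_ball p.2

/-- The germ of the monodromy as a homeomorphism of the disk of radius `R` onto its image. -/
def monodromyHomeomorph (h : IsSealable s a ε f R r) : OpenPartialHomeomorph ℂ ℂ :=
  OpenPartialHomeomorph.ofContinuousOpenRestrict (h.injOn.toPartialEquiv f (ball 0 R))
    (fun x hx => (h.contDiffAt x hx).continuousAt.continuousWithinAt)
    (by
      refine isOpenMap_iff_nhds_le.2 fun x => ?_
      have hs := (h.contDiffAt x x.2).hasStrictDerivAt (by simp)
      rw [show ((h.injOn.toPartialEquiv f (ball 0 R)).source.domRestrict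
        (h.injOn.toPartialEquiv f (ball 0 R))) = f ∘ Subtype.val from rfl, ← map_map]
      rw [map_nhds_subtype_val, IsOpen.nhdsWithin_eq (s := (h.injOn.toPartialEquiv f _).source)
        isOpen_ball x.2]
      exact (hs.map_nhds_eq (h.deriv_ne_zero x x.2)).ge) isOpen_ball

theorem contDiffAt_monodromyHomeomorph_symm (h : IsSealable s a ε f R r) {x : ℂ}
    (hx : x ∈ ball (0 : ℂ) R) : ContDiffAt ℂ ω (monodromyHomeomorph h).symm (f x) := by
  have hl : (monodromyHomeomorph h).symm (f x) = x := (monodromyHomeomorph h).left_inv hx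
  refine (monodromyHomeomorph h).contDiffAt_symm_deriv (h.deriv_ne_zero x hx)
    ((monodromyHomeomorph h).map_source hx) ?_ ?_
  · rw [hl]; exact ((h.contDiffAt x hx).differentiableAt (by simp)).hasDerivAt
  · rw [hl]; exact h.contDiffAt x hx

/-- The sealing in the rectifying chart: `(ζ, x) ↦ (ζ - 2 π i, f x)`. -/
def glue (h : IsSealable s a ε f R r) : OpenPartialHomeomorph (ℂ × ℂ) (ℂ × ℂ) :=
  (Homeomorph.addRight (-(2 * Real.pi * Complex.I) : ℂ)).toOpenPartialHomeomorph.prod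
    (monodromyHomeomorph h)

theorem glue_apply (h : IsSealable s a ε f R r) (z : ℂ × ℂ) :
    glue h z = (z.1 + -(2 * Real.pi * Complex.I), f z.2) := rfl

theorem glue_symm_apply (h : IsSealable s a ε f R r) (z : ℂ × ℂ) :
    (glue h).symm z = (z.1 + 2 * Real.pi * Complex.I, (monodromyHomeomorph h).symm z.2) := by
  refine Prod.ext ?_ rfl
  change z.1 + - -(2 * Real.pi * Complex.I) = _
  rw [neg_neg]

theorem coverChart_mem_glue_source (h : IsSealable s a ε f R r) (p : coverDomain r) :
    coverChart h p ∈ (glue h).source := ⟨trivial, coverChart_snd_mem h p⟩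

theorem isSealed_iff_glue (h : IsSealable s a ε f R r) {p q : coverDomain r} :
    IsSealed s a ε f p.1 q.1 ↔ glue h (coverChart h p) = coverChart h q := by
  rw [h.isSealed_iff_label p.2 q.2, glue_apply, coverChart_apply, coverChart_apply, Prod.ext_iff,
    ← sub_eq_add_neg]
  exact and_congr eq_comm eq_comm

theorem im_of_glue (h : IsSealable s a ε f R r) {p q : coverDomain r}
    (hpq : glue h (coverChart h p) = coverChart h q) : q.1.1.im = p.1.1.im - 2 * Real.pi := by
  have := congrArg (fun z : ℂ × ℂ => z.1.im) hpq
  simp only [glue_apply, coverChart_apply] at this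
  simp at this
  linarith

/-- Two successive gluings would lower the imaginary part by 4π, but the covering has height only
5π/2. -/
theorem not_glue_glue (h : IsSealable s a ε f R r) {p q t : coverDomain r}
    (hpq : glue h (coverChart h p) = coverChart h q)
    (hqt : glue h (coverChart h q) = coverChart h t) : False := by
  have h1 := im_of_glue h hpq
  have h2 := im_of_glue h hqt
  have h3 := t.2.1
  have h4 := p.2.2.1
  have := Real.pi_pos
  linarith

/-! ### The quotient -/

/-- The reflexive and symmetric closure of the gluing is already transitive: two gluings in a row
never occur, and the gluing is single-valued and injective. -/
theorem proj_eq_proj_iff (h : IsSealable s a ε f R r) {p q : coverDomain r} :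
    (SealedSpace.proj p : SealedSpace s a ε f r) = SealedSpace.proj q ↔
      p = q ∨ glue h (coverChart h p) = coverChart h q ∨
        glue h (coverChart h q) = coverChart h p := by
  constructor
  · intro hpq
    have hinj : ∀ {p q t : coverDomain r}, glue h (coverChart h p) = coverChart h t →
        glue h (coverChart h q) = coverChart h t → p = q := fun {p q t} hp hq =>
      coverChart_injective h ((glue h).injOn (coverChart_mem_glue_source h p)
        (coverChart_mem_glue_source h q) (hp.trans hq.symm))
    have := Quot.eqvGen_exact hpq
    clear hpq
    induction this with
    | rel p q hpq => exact Or.inr (Or.inl ((isSealed_iff_glue h).1 hpq))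
    | refl p => exact Or.inl rfl
    | symm p q _ ih =>
      rcases ih with rfl | ih | ih
      · exact Or.inl rfl
      · exact Or.inr (Or.inr ih)
      · exact Or.inr (Or.inl ih)
    | trans p q t _ _ ih ih' =>
      rcases ih with rfl | ih | ih
      · exact ih'
      · rcases ih' with rfl | ih' | ih'
        · exact Or.inr (Or.inl ih)
        · exact (not_glue_glue h ih ih').elim
        · exact Or.inl (hinj ih ih')
      · rcases ih' with rfl | ih' | ih'
        · exact Or.inr (Or.inr ih)
        · exact Or.inl (coverChart_injective h (ih.symm.trans ih'))
        · exact (not_glue_glue h ih' ih).elim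
  · rintro (rfl | hpq | hpq)
    · rfl
    · exact Quot.sound ((isSealed_iff_glue h).2 hpq)
    · exact Eq.symm (Quot.sound (r := fun p q : coverDomain r => IsSealed s a ε f p.1 q.1)
        ((isSealed_iff_glue h).2 hpq))

theorem continuous_proj :
    Continuous (SealedSpace.proj : coverDomain r → SealedSpace s a ε f r) :=
  continuous_quot_mk

/-- The saturation of an open set adds only its image and its preimage under the gluing, which is a
homeomorphism between open sets in the rectifying chart. -/
theorem isOpenMap_proj (h : IsSealable s a ε f R r) :
    IsOpenMap (SealedSpace.proj : coverDomain r → SealedSpace s a ε f r) := by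
  intro O hO
  have hopen : IsOpen (coverChart h '' O) := (coverChart h).isOpen_image_of_subset_source hO
    fun p _ => mem_coverChart_source h p
  have hsub : coverChart h '' O ⊆ (glue h).source := by
    rintro _ ⟨p, -, rfl⟩; exact coverChart_mem_glue_source h p
  have hglue : IsOpen (glue h '' (coverChart h '' O)) :=
    (glue h).isOpen_image_of_subset_source hopen hsub
  have hpre : IsOpen ((glue h).source ∩ glue h ⁻¹' (coverChart h '' O)) :=
    (glue h).isOpen_inter_preimage hopen
  change IsOpen ((SealedSpace.proj : coverDomain r → SealedSpace s a ε f r) ⁻¹'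
    (SealedSpace.proj '' O))
  have : (SealedSpace.proj : coverDomain r → SealedSpace s a ε f r) ⁻¹' (SealedSpace.proj '' O) =
      O ∪ (coverChart h ⁻¹' (glue h '' (coverChart h '' O)) ∪
        coverChart h ⁻¹' ((glue h).source ∩ glue h ⁻¹' (coverChart h '' O))) := by
    ext q
    constructor
    · rintro ⟨p, hp, hpq⟩
      rcases (proj_eq_proj_iff h).1 hpq with rfl | hpq | hpq
      · exact Or.inl hp
      · exact Or.inr (Or.inl ⟨_, mem_image_of_mem _ hp, hpq⟩)
      · exact Or.inr (Or.inr ⟨coverChart_mem_glue_source h q, p, hp, hpq.symm⟩)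
    · rintro (hq | ⟨_, ⟨p, hp, rfl⟩, hpq⟩ | ⟨-, p, hp, hpq⟩)
      · exact ⟨q, hq, rfl⟩
      · exact ⟨p, hp, (proj_eq_proj_iff h).2 (Or.inr (Or.inl hpq))⟩
      · exact ⟨p, hp, (proj_eq_proj_iff h).2 (Or.inr (Or.inr hpq.symm))⟩
  rw [this]
  exact hO.union ((hglue.preimage (continuous_coverChart h)).union
    (hpre.preimage (continuous_coverChart h)))

theorem proj_surjective :
    Function.Surjective (SealedSpace.proj : coverDomain r → SealedSpace s a ε f r) :=
  Quot.mk_surjective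

/-- For an open quotient map it suffices that the relation be closed. It is a union of three loci of
equality of continuous maps; what matters is that `glue` is defined on the whole image of the
covering, so no limit of identified pairs is lost. -/
theorem t2Space_sealedSpace (h : IsSealable s a ε f R r) : T2Space (SealedSpace s a ε f r) := by
  refine (t2Space_iff_of_isOpenQuotientMap
    ⟨proj_surjective, continuous_proj, isOpenMap_proj h⟩).2 ?_
  have he := continuous_coverChart h
  have hg : Continuous fun p : coverDomain r => glue h (coverChart h p) :=
    continuous_iff_continuousAt.2 fun p =>
      ((glue h).continuousAt (coverChart_mem_glue_source h p)).comp he.continuousAt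
  have h1 : IsClosed {q : coverDomain r × coverDomain r | q.1 = q.2} := isClosed_diagonal
  have h2 : IsClosed {q : coverDomain r × coverDomain r |
      glue h (coverChart h q.1) = coverChart h q.2} :=
    isClosed_eq (hg.comp continuous_fst) (he.comp continuous_snd)
  have h3 : IsClosed {q : coverDomain r × coverDomain r |
      glue h (coverChart h q.2) = coverChart h q.1} :=
    isClosed_eq (hg.comp continuous_snd) (he.comp continuous_fst)
  simp only [proj_eq_proj_iff h]
  exact h1.union (h2.union h3)

/-! ### Charts of the quotient -/

/-- Two open pieces of the covering on which the projection to the quotient is injective. -/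
def halfCover (r : ℝ) (b : Bool) : Set (coverDomain r) :=
  if b then {p | p.1.1.im < 7 * Real.pi / 4} else {p | Real.pi / 4 < p.1.1.im}

theorem isOpen_halfCover (r : ℝ) (b : Bool) : IsOpen (halfCover r b) := by
  cases b
  · exact isOpen_lt continuous_const (by fun_prop)
  · exact isOpen_lt (by fun_prop) continuous_const

theorem exists_mem_halfCover (p : coverDomain r) : ∃ b, p ∈ halfCover r b := by
  have := Real.pi_pos
  rcases lt_or_ge p.1.1.im (7 * Real.pi / 4) with hp | hp
  · exact ⟨true, hp⟩
  · exact ⟨false, show Real.pi / 4 < p.1.1.im by linarith⟩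

/-- Each piece is an open strip of height exactly 2π, and a gluing moves by exactly 2π. -/
theorem not_glue_of_mem_halfCover (h : IsSealable s a ε f R r) {b : Bool} {p q : coverDomain r}
    (hp : p ∈ halfCover r b) (hq : q ∈ halfCover r b) :
    glue h (coverChart h p) ≠ coverChart h q := by
  intro hpq
  have h1 := im_of_glue h hpq
  cases b
  · have hq : Real.pi / 4 < q.1.1.im := hq
    have := p.2.2.1
    linarith
  · have hp : p.1.1.im < 7 * Real.pi / 4 := hp
    have := q.2.1
    linarith

theorem injOn_proj (h : IsSealable s a ε f R r) (b : Bool) :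
    InjOn (SealedSpace.proj : coverDomain r → SealedSpace s a ε f r) (halfCover r b) := by
  intro p hp q hq hpq
  rcases (proj_eq_proj_iff h).1 hpq with hpq | hpq | hpq
  · exact hpq
  · exact (not_glue_of_mem_halfCover h hp hq hpq).elim
  · exact (not_glue_of_mem_halfCover h hq hp hpq).elim

/-- The projection restricted to one of the two pieces of the covering. -/
def projHomeomorph (h : IsSealable s a ε f R r) (b : Bool) :
    OpenPartialHomeomorph (coverDomain r) (SealedSpace s a ε f r) :=
  haveI := h.nonempty
  OpenPartialHomeomorph.ofContinuousOpen ((injOn_proj h b).toPartialEquiv _ _)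
    continuous_proj.continuousOn (isOpenMap_proj h) (isOpen_halfCover r b)

/-- The two charts of the quotient. -/
def sealedChart (h : IsSealable s a ε f R r) (b : Bool) :
    OpenPartialHomeomorph (SealedSpace s a ε f r) (ℂ × ℂ) :=
  (projHomeomorph h b).symm.trans (coverChart h)

theorem proj_mem_sealedChart_source (h : IsSealable s a ε f R r) {b : Bool} {p : coverDomain r}
    (hp : p ∈ halfCover r b) : SealedSpace.proj p ∈ (sealedChart h b).source := by
  rw [sealedChart, OpenPartialHomeomorph.trans_source, coverChart_source, preimage_univ, inter_univ]
  exact (projHomeomorph h b).map_source hp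

theorem exists_of_mem_sealedChart_source (h : IsSealable s a ε f R r) {b : Bool}
    {m : SealedSpace s a ε f r} (hm : m ∈ (sealedChart h b).source) :
    ∃ p ∈ halfCover r b, SealedSpace.proj p = m :=
  ⟨_, (projHomeomorph h b).map_target hm.1, (projHomeomorph h b).right_inv hm.1⟩

theorem sealedChart_proj (h : IsSealable s a ε f R r) {b : Bool} {p : coverDomain r}
    (hp : p ∈ halfCover r b) :
    sealedChart h b (SealedSpace.proj p : SealedSpace s a ε f r) = coverChart h p :=
  congrArg (coverChart h) ((projHomeomorph h b).left_inv hp)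

theorem sealedChart_symm (h : IsSealable s a ε f R r) (b : Bool) (z : ℂ × ℂ) :
    (sealedChart h b).symm z = SealedSpace.proj ((coverChart h).symm z) := rfl

theorem exists_mem_sealedChart_source (h : IsSealable s a ε f R r) (m : SealedSpace s a ε f r) :
    ∃ b, m ∈ (sealedChart h b).source := by
  obtain ⟨p, rfl⟩ := proj_surjective m
  obtain ⟨b, hb⟩ := exists_mem_halfCover p
  exact ⟨b, proj_mem_sealedChart_source h hb⟩

/-- The complex manifold structure of the quotient. -/
@[reducible]
def sealedChartedSpace (h : IsSealable s a ε f R r) :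
    ChartedSpace (ℂ × ℂ) (SealedSpace s a ε f r) where
  atlas := range (sealedChart h)
  chartAt m := sealedChart h (exists_mem_sealedChart_source h m).choose
  mem_chart_source m := (exists_mem_sealedChart_source h m).choose_spec
  chart_mem_atlas _ := mem_range_self _

/-- In the rectifying chart and in any chart of the quotient, the projection is locally the
product of a translation and an analytic map. -/
theorem exists_sealedChart_proj_eq (h : IsSealable s a ε f R r) {b : Bool} {p : coverDomain r}
    (hp : (SealedSpace.proj p : SealedSpace s a ε f r) ∈ (sealedChart h b).source) :
    ∃ (c : ℂ) (g : ℂ → ℂ), ContDiffAt ℂ ω g (coverChart h p).2 ∧ ∀ᶠ z in 𝓝 (coverChart h p),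
      sealedChart h b (SealedSpace.proj ((coverChart h).symm z)) = (z.1 + c, g z.2) := by
  obtain ⟨q, hq, hpq⟩ := exists_of_mem_sealedChart_source h hp
  have hopen : IsOpen (coverChart h '' halfCover r b) :=
    (coverChart h).isOpen_image_of_subset_source (isOpen_halfCover r b)
      fun p _ => mem_coverChart_source h p
  have hpt : ∀ᶠ z in 𝓝 (coverChart h p), z ∈ (coverChart h).target :=
    (coverChart h).open_target.mem_nhds ((coverChart h).map_source (mem_coverChart_source h p))
  -- The chart's representative q is p itself, or is glued onto p, or is the image of p; the local
  -- form is accordingly the identity, `glue` inverse or `glue`, and persists nearby because the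
  -- piece containing q is open.
  rcases (proj_eq_proj_iff h).1 hpq with rfl | hqp | hpq
  · refine ⟨0, id, contDiffAt_id, ?_⟩
    filter_upwards [hopen.mem_nhds (mem_image_of_mem _ hq)] with z hz
    obtain ⟨t, ht, rfl⟩ := hz
    rw [coverChart_symm_apply, sealedChart_proj h ht, add_zero]
    rfl
  · have hback : (glue h).symm (coverChart h p) = coverChart h q := by
      rw [← hqp]; exact (glue h).left_inv (coverChart_mem_glue_source h q)
    have hmem : coverChart h p ∈ (glue h).target := by
      rw [← hqp]; exact (glue h).map_source (coverChart_mem_glue_source h q)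
    refine ⟨2 * Real.pi * Complex.I, (monodromyHomeomorph h).symm, ?_, ?_⟩
    · rw [← hqp]; exact contDiffAt_monodromyHomeomorph_symm h (coverChart_snd_mem h q)
    · have hc := (glue h).symm.continuousAt hmem
      rw [ContinuousAt, hback] at hc
      filter_upwards [hc.eventually (hopen.mem_nhds (mem_image_of_mem _ hq)), hpt,
        (glue h).open_target.mem_nhds hmem] with z hz hzt hzg
      obtain ⟨t, ht, hzt'⟩ := hz
      rw [← glue_symm_apply, ← hzt', ← sealedChart_proj h ht]
      congr 1
      refine (proj_eq_proj_iff h).2 (Or.inr (Or.inr ?_))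
      rw [hzt', (coverChart h).right_inv hzt]
      exact (glue h).right_inv hzg
  · refine ⟨-(2 * Real.pi * Complex.I), f, h.contDiffAt _ (coverChart_snd_mem h p), ?_⟩
    have hc := (glue h).continuousAt (coverChart_mem_glue_source h p)
    rw [ContinuousAt, hpq] at hc
    filter_upwards [hc.eventually (hopen.mem_nhds (mem_image_of_mem _ hq)), hpt] with z hz hzt
    obtain ⟨t, ht, hzt'⟩ := hz
    rw [← glue_apply h, ← hzt', ← sealedChart_proj h ht]
    congr 1
    refine (proj_eq_proj_iff h).2 (Or.inr (Or.inl ?_))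
    rw [(coverChart h).right_inv hzt, hzt']

theorem isManifold_sealedSpace (h : IsSealable s a ε f R r) :
    letI := sealedChartedSpace h
    IsManifold 𝓘(ℂ, ℂ × ℂ) ω (SealedSpace s a ε f r) := by
  let _ := sealedChartedSpace h
  refine isManifold_of_contDiffOn _ _ _ ?_
  rintro _ _ ⟨b, rfl⟩ ⟨c, rfl⟩ z ⟨hz, -⟩
  have hz1 : z ∈ (sealedChart h b).target := hz.1
  have hzt : z ∈ (coverChart h).target := hz1.1
  have hz2 : SealedSpace.proj ((coverChart h).symm z) ∈ (sealedChart h c).source := hz.2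
  obtain ⟨d, g, hg, hev⟩ := exists_sealedChart_proj_eq h hz2
  rw [(coverChart h).right_inv hzt] at hg hev
  have : ContDiffAt ℂ ω (fun z : ℂ × ℂ => (z.1 + d, g z.2)) z :=
    (contDiffAt_fst.add contDiffAt_const).prodMk (hg.comp z contDiffAt_snd)
  exact (this.congr_of_eventuallyEq hev).contDiffWithinAt

/-! ### The complex structure and the induced vector field -/

theorem contMDiff_coverChart (h : IsSealable s a ε f R r) :
    ContMDiff 𝓘(ℂ, ℂ × ℂ) 𝓘(ℂ, ℂ × ℂ) ω (coverChart h) := fun p =>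
  ContMDiffAt.comp p (g := rectify h) (f := (Subtype.val : coverDomain r → ℂ × ℂ))
    (((contDiffOn_rectify h).contDiffAt ((rectify h).open_source.mem_nhds p.2)).contMDiffAt)
    contMDiff_subtype_val.contMDiffAt

theorem chartAt_coverDomain (h : IsSealable s a ε f R r) (p : coverDomain r) :
    chartAt (ℂ × ℂ) p = (coverDomain r).openPartialHomeomorphSubtypeCoe h.nonempty := by
  rw [TopologicalSpace.Opens.chartAt_eq, chartAt_self_eq, OpenPartialHomeomorph.subtypeRestr_def]
  exact OpenPartialHomeomorph.trans_refl _

theorem contMDiffOn_coverChart_symm (h : IsSealable s a ε f R r) :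
    ContMDiffOn 𝓘(ℂ, ℂ × ℂ) 𝓘(ℂ, ℂ × ℂ) ω (coverChart h).symm (coverChart h).target := by
  obtain ⟨p⟩ := h.nonempty
  have h1 := contMDiffOn_symm_of_mem_maximalAtlas (I := 𝓘(ℂ, ℂ × ℂ)) (n := ω)
    (IsManifold.chart_mem_maximalAtlas (I := 𝓘(ℂ, ℂ × ℂ)) (n := ω) p)
  rw [chartAt_coverDomain h] at h1
  exact h1.comp ((contDiffOn_rectify_symm h).contMDiffOn.mono inter_subset_left)
    fun z hz => hz.2

/-- On each half of the covering, `proj` followed by the quotient chart is `coverChart`, which is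
biholomorphic onto its image. -/
theorem isLocalDiffeomorph_proj (h : IsSealable s a ε f R r) :
    let _ := sealedChartedSpace h
    IsLocalDiffeomorph 𝓘(ℂ, ℂ × ℂ) 𝓘(ℂ, ℂ × ℂ) ω
      (SealedSpace.proj : coverDomain r → SealedSpace s a ε f r) := by
  intro _ p
  have := isManifold_sealedSpace h
  obtain ⟨b, hb⟩ := exists_mem_halfCover p
  have hatlas : sealedChart h b ∈
      IsManifold.maximalAtlas 𝓘(ℂ, ℂ × ℂ) ω (SealedSpace s a ε f r) :=
    IsManifold.subset_maximalAtlas (mem_range_self b)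
  have hsource : (projHomeomorph h b).target ⊆ (sealedChart h b).source := by
    intro m hm
    rw [← (projHomeomorph h b).right_inv hm]
    exact proj_mem_sealedChart_source h ((projHomeomorph h b).map_target hm)
  refine ⟨{ (projHomeomorph h b) with
    contMDiffOn_toFun := ?_
    contMDiffOn_invFun := ?_ }, hb, fun q _ => rfl⟩
  · have h1 := (contMDiffOn_symm_of_mem_maximalAtlas hatlas).comp
      (contMDiff_coverChart h).contMDiffOn (s := halfCover r b) fun q hq => by
        change coverChart h q ∈ (sealedChart h b).target
        rw [← sealedChart_proj h hq]
        exact (sealedChart h b).map_source (proj_mem_sealedChart_source h hq)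
    refine h1.congr fun q hq => ?_
    simp only [Function.comp, sealedChart_symm, coverChart_symm_apply]
    rfl
  · have h1 := (contMDiffOn_coverChart_symm h).comp
      ((contMDiffOn_of_mem_maximalAtlas hatlas).mono hsource)
      fun m hm => (coverChart h).map_source (mem_coverChart_source h _)
    refine h1.congr fun m hm => ?_
    exact (coverChart_symm_apply h _).symm

theorem isComplexManifold_sealedSpace (h : IsSealable s a ε f R r) :
    SealedSpace.IsComplexManifold (sealedChartedSpace h) where
  hausdorff := t2Space_sealedSpace h
  isManifold := isManifold_sealedSpace h
  proj_local_biholomorphism := isLocalDiffeomorph_proj h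

/-- The induced field is the constant field `(2 i, 0)` in the charts of the quotient. -/
def sealedField (h : IsSealable s a ε f R r) :
    let _ := sealedChartedSpace h
    ∀ m : SealedSpace s a ε f r, TangentSpace 𝓘(ℂ, ℂ × ℂ) m :=
  fun _ => ((2 * Complex.I, 0) : ℂ × ℂ)

theorem hasFDerivAt_translation_prod {z : ℂ × ℂ} {c : ℂ} {g : ℂ → ℂ}
    (hg : ContDiffAt ℂ ω g z.2) : HasFDerivAt (fun z : ℂ × ℂ => (z.1 + c, g z.2))
      ((ContinuousLinearMap.fst ℂ ℂ ℂ).prod (deriv g z.2 • ContinuousLinearMap.snd ℂ ℂ ℂ)) z := by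
  have h1 : HasFDerivAt (fun z : ℂ × ℂ => g z.2)
      (deriv g z.2 • ContinuousLinearMap.snd ℂ ℂ ℂ) z :=
    HasDerivAt.comp_hasFDerivAt z (hg.differentiableAt (by simp)).hasDerivAt hasFDerivAt_snd
  exact (hasFDerivAt_fst.add_const c).prodMk h1

/-- Read in charts, the projection is a translation in ζ times a map of the label alone, and the
derivative of such a product fixes (2i, 0). The constant field is thus consistent across the gluing.
-/
theorem isInducedField_sealedField (h : IsSealable s a ε f R r) :
    let _ := sealedChartedSpace h
    SealedSpace.IsInducedField (sealedField h) := by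
  intro _ p
  obtain ⟨b, hb, hbs⟩ : ∃ b, chartAt (ℂ × ℂ) (SealedSpace.proj p : SealedSpace s a ε f r) =
      sealedChart h b ∧ (SealedSpace.proj p : SealedSpace s a ε f r) ∈ (sealedChart h b).source :=
    ⟨_, rfl, (exists_mem_sealedChart_source h _).choose_spec⟩
  obtain ⟨c, g, hg, hev⟩ := exists_sealedChart_proj_eq h hbs
  have hT := hasFDerivAt_translation_prod (c := c) hg
  have hr : HasFDerivAt (rectify h) (fderiv ℂ (rectify h) p.1) p.1 :=
    (((contDiffOn_rectify h).differentiableOn (by simp)).differentiableAt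
      ((rectify h).open_source.mem_nhds p.2)).hasFDerivAt
  have hcomp := HasFDerivAt.comp p.1 (g := fun z : ℂ × ℂ => (z.1 + c, g z.2)) hT hr
  have heq : writtenInExtChartAt 𝓘(ℂ, ℂ × ℂ) 𝓘(ℂ, ℂ × ℂ) p
      (SealedSpace.proj : coverDomain r → SealedSpace s a ε f r) =ᶠ[𝓝 p.1]
      (fun z : ℂ × ℂ => (z.1 + c, g z.2)) ∘ rectify h := by
    have h1 := hr.continuousAt.eventually hev
    filter_upwards [h1, (coverDomain r).isOpen.mem_nhds p.2] with z hz hzc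
    rw [Function.comp, ← hz]
    have h2 : (coverChart h).symm (rectify h z) = ⟨z, hzc⟩ := coverChart_symm_apply h ⟨z, hzc⟩
    simp only [writtenInExtChartAt, extChartAt, hb, chartAt_coverDomain h, Function.comp]
    simp only [mfld_simps]
    rw [h2]
    congr 2
    exact ((coverDomain r).openPartialHomeomorphSubtypeCoe h.nonempty).left_inv
      (x := ⟨z, hzc⟩) (by simp)
  have hx : extChartAt 𝓘(ℂ, ℂ × ℂ) p p = p.1 := by
    simp only [extChartAt, chartAt_coverDomain h]
    simp only [mfld_simps]
  have hm : HasMFDerivAt 𝓘(ℂ, ℂ × ℂ) 𝓘(ℂ, ℂ × ℂ)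
      (SealedSpace.proj : coverDomain r → SealedSpace s a ε f r) p
      (((ContinuousLinearMap.fst ℂ ℂ ℂ).prod (deriv g (coverChart h p).2 •
        ContinuousLinearMap.snd ℂ ℂ ℂ)).comp (fderiv ℂ (rectify h) p.1)) := by
    refine ⟨continuous_proj.continuousAt, ?_⟩
    rw [hx]
    exact (hcomp.congr_of_eventuallyEq heq).hasFDerivWithinAt
  refine (DFunLike.congr_fun hm.mfderiv _).trans ?_
  change ((ContinuousLinearMap.fst ℂ ℂ ℂ).prod _) (fderiv ℂ (rectify h) p.1 _) = _
  rw [fderiv_rectify_liftedField h p.2]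
  change ((2 * Complex.I, deriv g _ • (0 : ℂ)) : ℂ × ℂ) = (2 * Complex.I, 0)
  rw [smul_zero]

/-! ### Lifts of the loop to the leaves -/

theorem base_eq_exp_sealedChart (h : IsSealable s a ε f R r) {b : Bool}
    {m : SealedSpace s a ε f r} (hm : m ∈ (sealedChart h b).source) :
    m.base = Complex.exp (sealedChart h b m).1 := by
  obtain ⟨p, hp, rfl⟩ := exists_of_mem_sealedChart_source h hm
  rw [sealedChart_proj h hp]
  rfl

theorem hasMFDerivWithinAt_sealedSpace_iff (h : IsSealable s a ε f R r)
    {γ : ℝ → SealedSpace s a ε f r} {S : Set ℝ} {θ : ℝ} {k : ℂ × ℂ} :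
    let _ := sealedChartedSpace h
    HasMFDerivWithinAt 𝓘(ℝ, ℝ) 𝓘(ℝ, ℂ × ℂ) γ S θ
      (ContinuousLinearMap.smulRight (1 : ℝ →L[ℝ] ℝ) k) ↔ ContinuousWithinAt γ S θ ∧
        HasDerivWithinAt (fun τ => chartAt (ℂ × ℂ) (γ θ) (γ τ)) k S θ := by
  intro _
  rw [HasMFDerivWithinAt, hasDerivWithinAt_iff_hasFDerivWithinAt]
  refine and_congr_right fun _ => ?_
  simp only [mfld_simps]
  exact Iff.rfl

/-- In any chart of the quotient, a lift of the loop has the velocity `(i, 0)`. -/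
theorem hasDerivWithinAt_sealedChart_leafLift (h : IsSealable s a ε f R r)
    {γ : ℝ → SealedSpace s a ε f r}
    (hγ : let _ := sealedChartedSpace h; SealedSpace.IsLeafLiftOfLoop (sealedField h) γ)
    {b : Bool} {θ : ℝ} (hθ : θ ∈ Icc 0 (2 * Real.pi)) (hb : γ θ ∈ (sealedChart h b).source) :
    HasDerivWithinAt (fun τ => sealedChart h b (γ τ)) (Complex.I, (0 : ℂ))
      (Icc 0 (2 * Real.pi)) θ := by
  let _ := sealedChartedSpace h
  obtain ⟨-, c, hc⟩ := hγ θ hθ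
  obtain ⟨hcont, hder⟩ := (hasMFDerivWithinAt_sealedSpace_iff h).1 hc
  obtain ⟨b₀, hb₀, hs₀⟩ : ∃ b₀, chartAt (ℂ × ℂ) (γ θ) = sealedChart h b₀ ∧
      γ θ ∈ (sealedChart h b₀).source :=
    ⟨_, rfl, (exists_mem_sealedChart_source h _).choose_spec⟩
  rw [hb₀] at hder
  obtain ⟨p, hp, hpγ⟩ := exists_of_mem_sealedChart_source h hs₀
  obtain ⟨d, g, hg, hev⟩ := exists_sealedChart_proj_eq h (p := p) (hpγ ▸ hb)
  have hz : sealedChart h b₀ (γ θ) = coverChart h p := by rw [← hpγ, sealedChart_proj h hp]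
  have hT := (hasFDerivAt_translation_prod (c := d) hg).restrictScalars ℝ
  rw [← hz] at hT hev
  -- The leaf condition is stated in the preferred chart at γ θ, which need not be b; the change of
  -- chart preserves vectors of the form (·, 0).
  have h1 := hT.comp_hasDerivWithinAt θ hder
  have h2 : HasDerivWithinAt (fun τ => sealedChart h b (γ τ)) (c * (2 * Complex.I), (0 : ℂ))
      (Icc 0 (2 * Real.pi)) θ := by
    have h3 : HasDerivWithinAt ((fun z : ℂ × ℂ => (z.1 + d, g z.2)) ∘
        fun τ => sealedChart h b₀ (γ τ)) (c * (2 * Complex.I), (0 : ℂ))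
        (Icc 0 (2 * Real.pi)) θ := by
      convert! h1 using 1
      refine Prod.ext rfl ?_
      change (0 : ℂ) = deriv g _ • (c • (0 : ℂ))
      rw [smul_zero, smul_zero]
    have h4 := hder.continuousWithinAt.eventually hev
    have h5 := hcont.eventually ((sealedChart h b₀).open_source.mem_nhds hs₀)
    have h6 : ∀ᶠ τ in 𝓝[Icc 0 (2 * Real.pi)] θ, sealedChart h b (γ τ) =
        ((fun z : ℂ × ℂ => (z.1 + d, g z.2)) ∘ fun τ => sealedChart h b₀ (γ τ)) τ := by
      filter_upwards [h4, h5] with τ h4 h5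
      rw [Function.comp, ← h4, ← sealedChart_symm, (sealedChart h b₀).left_inv h5]
    exact h3.congr_of_eventuallyEq h6 (h6.self_of_nhdsWithin hθ)
  -- The projection to the base is the prescribed loop, so comparing derivatives of e^ζ and e^{iτ}
  -- forces 2ic = i.
  have hexp : HasDerivWithinAt (fun τ => Complex.exp (sealedChart h b (γ τ)).1)
      (Complex.exp (sealedChart h b (γ θ)).1 * (c * (2 * Complex.I))) (Icc 0 (2 * Real.pi)) θ :=
    ((ContinuousLinearMap.fst ℝ ℂ ℂ).hasFDerivAt.comp_hasDerivWithinAt θ h2).cexp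
  have hexp' : HasDerivWithinAt (fun τ : ℝ => Complex.exp (τ * Complex.I))
      (Complex.exp (θ * Complex.I) * Complex.I) (Icc 0 (2 * Real.pi)) θ := by
    have : HasDerivAt (fun τ : ℝ => (τ : ℂ) * Complex.I) Complex.I θ := by
      simpa using (Complex.ofRealCLM.hasDerivAt (x := θ)).mul_const Complex.I
    exact this.cexp.hasDerivWithinAt
  have hev' : ∀ᶠ τ in 𝓝[Icc 0 (2 * Real.pi)] θ, Complex.exp (sealedChart h b (γ τ)).1 =
      Complex.exp (τ * Complex.I) := by
    filter_upwards [hcont.eventually ((sealedChart h b).open_source.mem_nhds hb),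
      self_mem_nhdsWithin] with τ h5 hτ
    rw [← base_eq_exp_sealedChart h h5, (hγ τ hτ).1]
  have hval := hev'.self_of_nhdsWithin hθ
  have huniq := (uniqueDiffOn_Icc (by positivity : (0 : ℝ) < 2 * Real.pi) θ hθ).eq_deriv _ hexp
    (hexp'.congr_of_eventuallyEq hev' hval)
  rw [hval] at huniq
  rwa [mul_left_cancel₀ (Complex.exp_ne_zero _) huniq] at h2

/-- A leaf lift of the loop is determined by its starting point. -/
theorem eqOn_of_isLeafLiftOfLoop (h : IsSealable s a ε f R r) {γ₁ γ₂ : ℝ → SealedSpace s a ε f r}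
    (h₁ : let _ := sealedChartedSpace h; SealedSpace.IsLeafLiftOfLoop (sealedField h) γ₁)
    (h₂ : let _ := sealedChartedSpace h; SealedSpace.IsLeafLiftOfLoop (sealedField h) γ₂)
    (h0 : γ₁ 0 = γ₂ 0) : EqOn γ₁ γ₂ (Icc 0 (2 * Real.pi)) := by
  have := t2Space_sealedSpace h
  have hc : ∀ {γ : ℝ → SealedSpace s a ε f r},
      (let _ := sealedChartedSpace h; SealedSpace.IsLeafLiftOfLoop (sealedField h) γ) →
        ContinuousOn γ (Icc 0 (2 * Real.pi)) := fun {γ} hγ θ hθ => by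
    obtain ⟨-, c, hc⟩ := hγ θ hθ
    exact hc.1
  have hclosed : IsClosed ({θ | γ₁ θ = γ₂ θ} ∩ Icc 0 (2 * Real.pi)) := by
    rw [inter_comm]
    exact ((hc h₁).prodMk (hc h₂)).preimage_isClosed_of_isClosed isClosed_Icc isClosed_diagonal
  -- Continuous induction: the coincidence set is closed by Hausdorffness, and just beyond a
  -- coincidence both lifts lie in one chart with the same velocity (i, 0), so their difference
  -- there is constant.
  refine hclosed.Icc_subset_of_forall_exists_gt h0 fun θ hθ y hy => ?_
  obtain ⟨heq, hθ⟩ := hθ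
  have heq : γ₁ θ = γ₂ θ := heq
  have hθ' := Ico_subset_Icc_self hθ
  obtain ⟨b, hb⟩ := exists_mem_sealedChart_source h (γ₁ θ)
  have hopen := (sealedChart h b).open_source
  have hev := (((hc h₁) θ hθ').eventually (hopen.mem_nhds hb)).and
    (((hc h₂) θ hθ').eventually (hopen.mem_nhds (heq ▸ hb)))
  obtain ⟨δ, hδ, hball⟩ := Metric.mem_nhdsWithin_iff.1 hev
  obtain ⟨u, hu1, hu2⟩ := exists_between (lt_min (lt_min hy hθ.2) (lt_add_of_pos_right θ hδ))
  have huy : u < y := hu2.trans_le ((min_le_left _ _).trans (min_le_left _ _))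
  have hu2π : u < 2 * Real.pi := hu2.trans_le ((min_le_left _ _).trans (min_le_right _ _))
  have huδ : u < θ + δ := hu2.trans_le (min_le_right _ _)
  have hsub : ∀ τ ∈ Icc θ u, τ ∈ Icc 0 (2 * Real.pi) ∧
      γ₁ τ ∈ (sealedChart h b).source ∧ γ₂ τ ∈ (sealedChart h b).source := fun τ hτ => by
    have hτ' : τ ∈ Icc 0 (2 * Real.pi) := ⟨hθ.1.trans hτ.1, hτ.2.trans hu2π.le⟩
    refine ⟨hτ', hball ⟨?_, hτ'⟩⟩
    rw [mem_ball, Real.dist_eq, abs_of_nonneg (by linarith [hτ.1])]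
    linarith [hτ.2]
  have hder : ∀ τ ∈ Icc θ u, HasDerivWithinAt
      (fun τ => sealedChart h b (γ₁ τ) - sealedChart h b (γ₂ τ)) 0 (Icc 0 (2 * Real.pi)) τ :=
    fun τ hτ => by
      obtain ⟨hτ', hm₁, hm₂⟩ := hsub τ hτ
      rw [← sub_self ((Complex.I, 0) : ℂ × ℂ)]
      exact (hasDerivWithinAt_sealedChart_leafLift h h₁ hτ' hm₁).sub
        (hasDerivWithinAt_sealedChart_leafLift h h₂ hτ' hm₂)
  have hconst := constant_of_has_deriv_right_zero
    (fun τ hτ => (hder τ hτ).continuousWithinAt.mono fun t ht => (hsub t ht).1)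
    (fun τ hτ => hasDerivWithinAt_Ici_of_Icc
      ⟨hθ.1.trans hτ.1, hτ.2.trans hu2π⟩ (hder τ (Ico_subset_Icc_self hτ))) u ⟨hu1.le, le_rfl⟩
  rw [heq, sub_self, sub_eq_zero] at hconst
  obtain ⟨-, hm₁, hm₂⟩ := hsub u ⟨hu1.le, le_rfl⟩
  exact ⟨u, (sealedChart h b).injOn hm₁ hm₂ hconst, hu1, huy.le⟩

/-! ### The monodromy -/

theorem sectionPt_injective (h : IsSealable s a ε f R r) :
    Function.Injective (SealedSpace.sectionPt : ball (0 : ℂ) r → SealedSpace s a ε f r) := by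
  intro x y hxy
  have hm : ∀ (x : ℂ) (hx : ((0, x) : ℂ × ℂ) ∈ coverDomain r),
      (⟨(0, x), hx⟩ : coverDomain r) ∈ halfCover r true := fun x hx => by
    change (0 : ℂ).im < 7 * Real.pi / 4
    rw [Complex.zero_im]
    positivity
  have := injOn_proj h true (hm _ _) (hm _ _) hxy
  exact Subtype.ext (congrArg (fun p : coverDomain r => p.1.2) this)

theorem label_zero_left (x : ℂ) : label s a ε (0, x) = x := by
  rw [label]
  simp [flowMap_zero_left (contDiff_planarField s a ε)]

/-- The point over `i θ` of a leaf close to the zero leaf. -/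
theorem mem_coverChart_target (h : IsSealable s a ε f R r) {x : ℂ} (hx : ‖x‖ < r / 4) {θ : ℝ}
    (hθ : θ ∈ Icc 0 (2 * Real.pi)) : (θ * Complex.I, x) ∈ (coverChart h).target := by
  have hpi := Real.pi_lt_d2
  have hpi0 := Real.pi_pos
  have hθ0 := hθ.1
  have hθ1 := hθ.2
  have hn : ‖(θ * Complex.I) / (2 * Complex.I)‖ = θ / 2 := by
    simp [abs_of_nonneg hθ.1]
  -- The flow time is θ/2 ≤ π, so the growth is at most e^{π/8} < 3, and a label below r/4 stays
  -- below r along the whole loop.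
  have he : Real.exp (θ / 2 / 8) ≤ 3 :=
    (Real.exp_le_exp.2 (by linarith)).trans exp_one_le_three
  have hb : ‖x‖ * Real.exp (‖(θ * Complex.I) / (2 * Complex.I)‖ / 8) < r := by
    rw [hn]
    nlinarith [norm_nonneg x]
  have hrR : r ≤ R := by linarith [h.r_le, h.r_pos]
  have hl : ‖leafPt s a ε (θ * Complex.I, x)‖ < r := by
    have : ‖Complex.exp (-(θ * Complex.I / 2))‖ = 1 := by
      rw [Complex.norm_exp]; simp
    rw [leafPt, norm_mul, this, one_mul]
    exact (h.norm_flowMap_le (hb.le.trans hrR)).trans_lt hb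
  have hmem : (θ * Complex.I, leafPt s a ε (θ * Complex.I, x)) ∈ coverDomain r := by
    refine ⟨?_, ?_, hl, ?_⟩
    · simp; linarith
    · simp; linarith
    · rw [norm_mul, Complex.norm_exp_ofReal_mul_I, one_mul]; exact hl
  refine ⟨⟨hb.trans_le hrR, hmem⟩, ?_⟩
  change (rectify h).symm (θ * Complex.I, x) ∈
    ((coverDomain r).openPartialHomeomorphSubtypeCoe h.nonempty).target
  rw [TopologicalSpace.Opens.openPartialHomeomorphSubtypeCoe_target]
  exact hmem

/-- The lift of the loop to the leaf with label `x`. -/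
theorem isLeafLiftOfLoop_leaf (h : IsSealable s a ε f R r) {x : ℂ} (hx : ‖x‖ < r / 4) :
    letI := sealedChartedSpace h
    SealedSpace.IsLeafLiftOfLoop (sealedField h) fun θ : ℝ =>
      (SealedSpace.proj ((coverChart h).symm (θ * Complex.I, x)) : SealedSpace s a ε f r) := by
  let _ := sealedChartedSpace h
  intro θ hθ
  have htar := mem_coverChart_target h hx hθ
  set p := (coverChart h).symm (θ * Complex.I, x) with hp
  have hcp : coverChart h p = (θ * Complex.I, x) := (coverChart h).right_inv htar
  constructor
  · have : p.1.1 = θ * Complex.I := congrArg Prod.fst hcp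
    change Complex.exp p.1.1 = _
    rw [this]
  -- The curve has velocity (i, 0), half of the field (2i, 0).
  refine ⟨1 / 2, (hasMFDerivWithinAt_sealedSpace_iff h).2 ⟨?_, ?_⟩⟩
  · have h1 : ContinuousAt (fun θ : ℝ => ((θ * Complex.I, x) : ℂ × ℂ)) θ := by fun_prop
    have h2 := ((coverChart h).symm.continuousAt htar).comp
      (f := fun θ : ℝ => ((θ * Complex.I, x) : ℂ × ℂ)) h1
    exact (continuous_proj.continuousAt.comp h2).continuousWithinAt
  · obtain ⟨b, hb, hs⟩ : ∃ b, chartAt (ℂ × ℂ) (SealedSpace.proj p : SealedSpace s a ε f r) =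
        sealedChart h b ∧
        (SealedSpace.proj p : SealedSpace s a ε f r) ∈ (sealedChart h b).source :=
      ⟨_, rfl, (exists_mem_sealedChart_source h _).choose_spec⟩
    rw [hb]
    obtain ⟨d, g, hg, hev⟩ := exists_sealedChart_proj_eq h hs
    have hT := (hasFDerivAt_translation_prod (c := d) hg).restrictScalars ℝ
    rw [hcp] at hT hev
    have hcurve : HasDerivAt (fun τ : ℝ => ((τ * Complex.I, x) : ℂ × ℂ)) (Complex.I, 0) θ := by
      have : HasDerivAt (fun τ : ℝ => (τ : ℂ) * Complex.I) Complex.I θ := by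
        simpa using (Complex.ofRealCLM.hasDerivAt (x := θ)).mul_const Complex.I
      exact this.prodMk (hasDerivAt_const _ _)
    have h1 := hT.comp_hasDerivAt θ hcurve
    have h2 := h1.congr_of_eventuallyEq (hcurve.continuousAt.eventually hev)
    refine h2.hasDerivWithinAt.congr_deriv (Prod.ext ?_ ?_)
    · change Complex.I = (1 / 2 : ℂ) • (2 * Complex.I)
      rw [smul_eq_mul]; ring
    · change deriv g _ • (0 : ℂ) = (1 / 2 : ℂ) • (0 : ℂ)
      rw [smul_zero, smul_zero]

theorem proj_leaf_zero (h : IsSealable s a ε f R r) (x : ball (0 : ℂ) r) :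
    (SealedSpace.proj ((coverChart h).symm (((0 : ℝ) : ℂ) * Complex.I, x)) :
      SealedSpace s a ε f r) = SealedSpace.sectionPt x := by
  rw [Complex.ofReal_zero, zero_mul]
  refine congrArg SealedSpace.proj ?_
  have : ∀ hx : ((0, (x : ℂ)) : ℂ × ℂ) ∈ coverDomain r,
      (coverChart h).symm (0, (x : ℂ)) = ⟨(0, x), hx⟩ := fun hx => by
    rw [← coverChart_symm_apply h ⟨(0, x), hx⟩, coverChart_apply]
    simp only [label_zero_left]
  exact this _

/-- The end (2πi, x) of the lift lies over the end flap, and the gluing identifies it with (0, f x),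
which lies on the section; this is where the monodromy becomes `f`. -/
theorem proj_leaf_two_pi (h : IsSealable s a ε f R r) {x : ℂ} (hx : ‖x‖ < r / 4)
    (hfx : f x ∈ ball (0 : ℂ) r) :
    (SealedSpace.proj ((coverChart h).symm (((2 * Real.pi : ℝ) : ℂ) * Complex.I, x)) :
      SealedSpace s a ε f r) = SealedSpace.sectionPt ⟨f x, hfx⟩ := by
  refine (proj_eq_proj_iff h).2 (Or.inr (Or.inl ?_))
  rw [(coverChart h).right_inv (mem_coverChart_target h hx ⟨by positivity, le_rfl⟩),
    glue_apply, coverChart_apply]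
  simp only [label_zero_left]
  push_cast
  rw [add_neg_cancel]

theorem isMonodromy_iff (h : IsSealable s a ε f R r) {x : ball (0 : ℂ) r} (hx : ‖(x : ℂ)‖ < r / 4)
    {x' : ball (0 : ℂ) r} :
    letI := sealedChartedSpace h
    SealedSpace.IsMonodromy (sealedField h) x x' ↔ (x' : ℂ) = f x := by
  have hpi := Real.pi_pos
  have hfx : f x ∈ ball (0 : ℂ) r := by
    have := h.norm_le x (by rw [mem_ball_zero_iff]; linarith [h.r_le, h.r_pos])
    rw [mem_ball_zero_iff]
    linarith [h.r_pos]
  have hleaf := isLeafLiftOfLoop_leaf h hx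
  constructor
  · rintro ⟨γ, hγ, h0, h1⟩
    have heq := eqOn_of_isLeafLiftOfLoop h hγ hleaf (h0.trans (proj_leaf_zero h x).symm)
      (right_mem_Icc.2 (by positivity))
    have := sectionPt_injective h (h1.symm.trans (heq.trans (proj_leaf_two_pi h hx hfx)))
    exact congrArg Subtype.val this
  · intro hx'
    refine ⟨_, hleaf, proj_leaf_zero h x, ?_⟩
    refine (proj_leaf_two_pi h hx hfx).trans (congrArg _ ?_)
    exact Subtype.ext hx'.symm

/-! ### Uniform bounds near the origin -/

/-- A holomorphic family whose member at `0` has the multiplier `-1` at `0` is, uniformly in the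
parameter, injective and at most doubling on a small disk. -/
theorem IsAdmissible.exists_bounds {s : ℂ} {Q : ℂ → ℂ → ℂ} (hQ : IsAdmissible s Q) :
    ∃ δ > (0 : ℝ), ∀ ε : ℂ, ‖ε‖ < δ → (∀ x ∈ ball (0 : ℂ) δ, ContDiffAt ℂ ω (Q ε) x) ∧
      (∀ x ∈ ball (0 : ℂ) δ, deriv (Q ε) x ≠ 0) ∧ InjOn (Q ε) (ball 0 δ) ∧
      ∀ x ∈ ball (0 : ℂ) δ, ‖Q ε x‖ ≤ 2 * ‖x‖ := by
  set F : ℂ × ℂ → ℂ := fun p => Q p.1 p.2 with hF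
  have han := hQ.holomorphic.eventually_analyticAt
  have hslice : ∀ {p : ℂ × ℂ}, AnalyticAt ℂ F p →
      HasDerivAt (Q p.1) (fderiv ℂ F p (0, 1)) p.2 := fun {p} hp => by
    have h1 : HasDerivAt (fun x : ℂ => (p.1, x)) ((0, 1) : ℂ × ℂ) p.2 :=
      (hasDerivAt_const _ _).prodMk (hasDerivAt_id _)
    exact HasFDerivAt.comp_hasDerivAt p.2 hp.differentiableAt.hasFDerivAt h1
  have hcont : ContinuousAt (fun p => fderiv ℂ F p (0, 1)) (0, 0) :=
    hQ.holomorphic.fderiv.continuousAt.clm_apply continuousAt_const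
  have h0 : fderiv ℂ F (0, 0) (0, 1) = -1 := by
    rw [← hQ.multiplier]; exact (hslice hQ.holomorphic).deriv.symm
  have hnear : ∀ᶠ p in 𝓝 ((0, 0) : ℂ × ℂ), ‖fderiv ℂ F p (0, 1) + 1‖ < 1 / 2 := by
    have : ContinuousAt (fun p => ‖fderiv ℂ F p (0, 1) + 1‖) (0, 0) :=
      (hcont.add continuousAt_const).norm
    refine this.eventually (gt_mem_nhds ?_)
    change ‖fderiv ℂ F (0, 0) (0, 1) + 1‖ < 1 / 2
    rw [h0]; norm_num
  obtain ⟨δ₁, hδ₁, hb₁⟩ := Metric.eventually_nhds_iff_ball.1 (han.and hnear)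
  obtain ⟨δ₂, hδ₂, hb₂⟩ := Metric.eventually_nhds_iff_ball.1 hQ.fixes_zero
  refine ⟨min δ₁ δ₂, lt_min hδ₁ hδ₂, fun ε hε => ?_⟩
  have hmem : ∀ x ∈ ball (0 : ℂ) (min δ₁ δ₂), AnalyticAt ℂ F (ε, x) ∧
      ‖fderiv ℂ F (ε, x) (0, 1) + 1‖ < 1 / 2 := fun x hx => by
    refine hb₁ (ε, x) ?_
    rw [mem_ball_zero_iff] at hx
    rw [show ((0, 0) : ℂ × ℂ) = 0 from rfl, mem_ball_zero_iff, Prod.norm_def]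
    exact max_lt (hε.trans_le (min_le_left _ _)) (hx.trans_le (min_le_left _ _))
  have hder : ∀ x ∈ ball (0 : ℂ) (min δ₁ δ₂),
      HasDerivAt (Q ε) (fderiv ℂ F (ε, x) (0, 1)) x := fun x hx => hslice (hmem x hx).1
  have hz : Q ε 0 = 0 := hb₂ ε (by
    rw [mem_ball_zero_iff]; exact hε.trans_le (min_le_right _ _))
  -- Since the derivative of Q is near -1, the sum Q + id is 1/2-Lipschitz on the ball; this yields
  -- both injectivity and |Q x| ≤ (3/2)|x|.
  have hlip : ∀ x ∈ ball (0 : ℂ) (min δ₁ δ₂), ∀ y ∈ ball (0 : ℂ) (min δ₁ δ₂),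
      ‖(Q ε y + y) - (Q ε x + x)‖ ≤ 1 / 2 * ‖y - x‖ := fun x hx y hy =>
    (convex_ball (0 : ℂ) _).norm_image_sub_le_of_norm_hasDerivWithin_le
      (fun z hz => ((hder z hz).add (hasDerivAt_id z)).hasDerivWithinAt)
      (fun z hz => (hmem z hz).2.le) hx hy
  refine ⟨fun x hx => ?_, fun x hx => ?_, fun x hx y hy hxy => ?_, fun x hx => ?_⟩
  · have h1 : AnalyticAt ℂ (fun x : ℂ => (ε, x)) x := analyticAt_const.prod analyticAt_id
    exact (AnalyticAt.comp (g := F) (hmem x hx).1 h1).contDiffAt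
  · rw [(hder x hx).deriv]
    intro h
    have := (hmem x hx).2
    rw [h] at this
    norm_num at this
  · have := hlip x hx y hy
    rw [hxy, add_sub_add_left_eq_sub] at this
    have h1 : ‖y - x‖ = 0 := le_antisymm (by linarith) (norm_nonneg _)
    exact (sub_eq_zero.1 (norm_eq_zero.1 h1)).symm
  · have h1 := hlip 0 (by simpa using hx.trans_le' dist_nonneg) x hx
    rw [hz, add_zero, sub_zero, sub_zero] at h1
    have h2 := norm_sub_le (Q ε x + x) x
    rw [add_sub_cancel_right] at h2
    linarith [norm_nonneg x]

theorem exists_norm_radial_le {A : ℂ → ℂ} (hA : ContinuousAt A 0) (s : ℂ) :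
    ∃ δ > (0 : ℝ), ∀ ε : ℂ, ‖ε‖ < δ → ∀ w : ℂ, ‖w‖ ≤ 2 * δ →
      ‖radial s (A ε) ε (w ^ 2)‖ ≤ 1 / 8 := by
  have hcont : ContinuousAt (fun p : ℂ × ℂ => radial s (A p.1) p.1 (p.2 ^ 2)) (0, 0) := by
    have hA' : ContinuousAt (fun p : ℂ × ℂ => A p.1) (0, 0) :=
      ContinuousAt.comp (f := Prod.fst) (x := ((0, 0) : ℂ × ℂ)) hA continuousAt_fst
    unfold radial
    fun_prop
  have hev : ∀ᶠ p in 𝓝 ((0, 0) : ℂ × ℂ), ‖radial s (A p.1) p.1 (p.2 ^ 2)‖ < 1 / 8 := by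
    refine hcont.norm.eventually (gt_mem_nhds ?_)
    simp [radial]
  obtain ⟨δ, hδ, hb⟩ := Metric.eventually_nhds_iff_ball.1 hev
  -- The bound is wanted for |w| up to twice the new radius, and 2δ/3 < δ.
  refine ⟨δ / 3, by positivity, fun ε hε w hw => (hb (ε, w) ?_).le⟩
  rw [show ((0, 0) : ℂ × ℂ) = 0 from rfl, mem_ball_zero_iff, Prod.norm_def]
  exact max_lt (by simp only; linarith) (by simp only; linarith)

end WeakFocus

end

theorem mainTheorem5 (s : ℂ) (hs : s = 1 ∨ s = -1) (A : ℂ → ℂ) (hA : AnalyticAt ℂ A 0)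
    (Q : ℂ → ℂ → ℂ) (hQ : WeakFocus.IsAdmissible s Q) :
    ∃ δ > (0 : ℝ), ∃ r₀ > (0 : ℝ), ∀ r : ℝ, 0 < r → r ≤ r₀ → ∃ ρ > (0 : ℝ), ρ ≤ r ∧
      ∀ ε : ℂ, ‖ε‖ < δ →
        (∀ p ∈ WeakFocus.coverDomain r, p.1 ∈ WeakFocus.flapEnd →
          ∃! q : ℂ × ℂ, WeakFocus.IsSealed s (A ε) ε (Q ε) p q) ∧
        ∃ cs : ChartedSpace (ℂ × ℂ) (WeakFocus.SealedSpace s (A ε) ε (Q ε) r),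
          WeakFocus.SealedSpace.IsComplexManifold cs ∧
          ∃ v : ∀ m : WeakFocus.SealedSpace s (A ε) ε (Q ε) r, TangentSpace 𝓘(ℂ, ℂ × ℂ) m,
            WeakFocus.SealedSpace.IsInducedField v ∧
            ∀ x : Metric.ball (0 : ℂ) r, ‖(x : ℂ)‖ < ρ →
              ‖Q ε x‖ < r ∧
              ∀ x' : Metric.ball (0 : ℂ) r,
                WeakFocus.SealedSpace.IsMonodromy v x x' ↔ (x' : ℂ) = Q ε x := by
  obtain ⟨δ₁, hδ₁, h₁⟩ := hQ.exists_bounds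
  obtain ⟨δ₂, hδ₂, h₂⟩ := WeakFocus.exists_norm_radial_le hA.continuousAt s
  have hδ : 0 < min δ₁ δ₂ := lt_min hδ₁ hδ₂
  -- The minimum serves both as the bound on ε and as the radius R of `IsSealable`; then r₀ = R/16,
  -- and ρ = r/4 does not depend on ε.
  refine ⟨min δ₁ δ₂, hδ, min δ₁ δ₂ / 16, by positivity, fun r hr hr₀ => ⟨r / 4, by positivity,
    by linarith, fun ε hε => ?_⟩⟩
  have hball : ball (0 : ℂ) (min δ₁ δ₂) ⊆ ball 0 δ₁ := ball_subset_ball (min_le_left _ _)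
  obtain ⟨hd, hd0, hinj, hle⟩ := h₁ ε (hε.trans_le (min_le_left _ _))
  have h : WeakFocus.IsSealable s (A ε) ε (Q ε) (min δ₁ δ₂) r :=
    { r_pos := hr
      r_le := by linarith
      norm_radial_le := fun w hw => h₂ ε (hε.trans_le (min_le_right _ _)) w
        (hw.trans (by linarith [min_le_right δ₁ δ₂]))
      contDiffAt := fun x hx => hd x (hball hx)
      deriv_ne_zero := fun x hx => hd0 x (hball hx)
      injOn := hinj.mono hball
      norm_le := fun x hx => hle x (hball hx) }
  refine ⟨fun p hp hpe => h.existsUnique_isSealed hp hpe, WeakFocus.sealedChartedSpace h,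
    WeakFocus.isComplexManifold_sealedSpace h, WeakFocus.sealedField h,
    WeakFocus.isInducedField_sealedField h, fun x hx => ⟨?_, fun x' => ?_⟩⟩
  · have h3 := h.norm_le x (by rw [mem_ball_zero_iff]; linarith)
    linarith
  · exact WeakFocus.isMonodromy_iff h hx
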